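/- **Setting.** Let $(\mathcal N,\mathcal E)$ be a connected finite graph with arbitrarily oriented lines (no loops, at most one orientation of each line), incidence matrix $C$ ($C_{j,e}=1$ if $e$ leaves $j$, $-1$ if $e$ enters $j$, $0$ otherwise), and positive diagonal matrices $M,D\in\mathbb R^{|\mathcal N|\times|\mathcal N|}$ (inertia, damping), $B\in\mathbb R^{|\mathcal E|\times|\mathcal E|}$ (line sensitivities). Let $d\in\mathbb R^{|\mathcal N|}$ be the demand, $\underline F,\overline F\in\mathbb R^{|\mathcal E|}$ the line limits, $F=[\overline F^T,-\underline F^T]^T$, and $H^T=[S^T,-S^T]^T$ with $S=BC^T(CBC^T)^\dagger$. Let $J_j:\mathbb R\to\mathbb R$ be strictly convex and twice differentiable. The planner's problem is $$\min_{p,q,\omega,\tilde\theta}\ \mathbf 1^TJ(p)+\tfrac12\omega^TD\omega\quad\text{s.t.}\quad q=p\,(\alpha),\ \ \mathbf 1^T(q-d)=0\,(\lambda),\ \ H^T(q-d)\le F\,(\eta\ge 0),\ \ q-d-D\omega-CB\tilde\theta=0\,(\nu),$$ and it is assumed to be feasible. Its Lagrangian is $$L=\mathbf 1^TJ(p)+\tfrac12\omega^TD\omega+\nu^T(q-d-D\omega-CB\tilde\theta)+\alpha^T(q-p)-\lambda\mathbf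 1^T(q-d)+\eta^T(H^T(q-d)-F).$$ **The loop.** Split the scalar variables into *eliminated* ones, which are set to their optimizers, and *dynamic* ones. All entries of $\omega$ are eliminated, all entries of $\tilde\theta$ and $\nu$ are dynamic, and for the entries of $p,q,\alpha,\lambda,\eta$ the choice is arbitrary. Let $z$ and $\sigma$ collect the dynamic primal and dual variables, and let $\hat L(z,\sigma)$ be the minimum over the eliminated primal variables of the maximum over the eliminated dual variables (with $\eta\ge0$ for eliminated entries of $\eta$) of $L$. The aligned grid-market-participant loop is the projected saddle flow $$T^z\dot z=-\nabla_z\hat L(z,\sigma),\qquad T^\sigma\dot\sigma=[\nabla_\sigma\hat L(z,\sigma)]^+_\eta ,$$ where $T^z,T^\sigma$ are positive diagonal matrices with $T^{\tilde\theta}=B$ and $T^\nu=M$, and where the projection acts only on the entries of $\eta$ in $\sigma$, replacing $y_e$ by $0$ unless $y_e>0$ or $\eta_e>0$. Trajectories are locally absolutely continuous functions on $[0,\infty)$ that satisfy these equations almost everywhere. Let $\mathbb I$ be the set of $(z,\sigma)$ whose entries of $\eta$ (if any) are nonnegative; trajectories start in $\mathbb I$. Let $\mathbb E$ be the set of equilibria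 of the loop in $\mathbb I$. **Theorem 3.** Assume 1. (finiteness) $\hat L(z,\sigma)$ is finite for all $(z,\sigma)$, and it is differentiable, so that the loop is well defined; 2. (observability) for every $(z^*,\sigma^*)\in\mathbb E$, every trajectory with $\hat L(z^*,\sigma(t))\equiv\hat L(z^*,\sigma^*)$ and $\hat L(z(t),\sigma^*)\equiv\hat L(z^*,\sigma^*)$ satisfies $\dot z\equiv0$, $\dot\sigma\equiv0$. Then $\mathbb E$ is globally asymptotically stable on $\mathbb I$: it is nonempty; for every $\varepsilon>0$ there is $\delta>0$ such that each trajectory that starts in $\mathbb I$ at distance less than $\delta$ from $\mathbb E$ stays at distance less than $\varepsilon$ from $\mathbb E$ for all $t\ge0$; and the distance to $\mathbb E$ of each trajectory starting in $\mathbb I$ tends to $0$. In particular, each trajectory $(z(t),\sigma(t))$ starting in $\mathbb I$ is bounded for $t\ge0$ and converges, as $t\to\infty$, to one point $(z^*,\sigma^*)\in\mathbb E$, and $(z^*,\sigma^*)$ corresponds to an optimal primal-dual solution of the planner's problem, i.e. it is completed to one by suitable values of the eliminated variables. -/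

import Mathlib

open scoped Matrix Topology

noncomputable section

namespace GridMarket

/-! ### Moore-Penrose inverse of a real symmetric matrix -/

/-- The Moore-Penrose inverse of a real symmetric matrix `A = U diag(a) Uᵀ`, namely
`U diag(a⁻¹) Uᵀ` with the convention `0⁻¹ = 0`. -/
def pinv {n : Type*} [Fintype n] [DecidableEq n] (A : Matrix n n ℝ) (hA : A.IsHermitian) :
    Matrix n n ℝ :=
  (hA.eigenvectorUnitary : Matrix n n ℝ) * Matrix.diagonal (fun i => (hA.eigenvalues i)⁻¹) *
    star (hA.eigenvectorUnitary : Matrix n n ℝ)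

/-- `pinv A` satisfies the four Penrose equations, which determine it uniquely. -/
theorem pinv_penrose {n : Type*} [Fintype n] [DecidableEq n] (A : Matrix n n ℝ)
    (hA : A.IsHermitian) :
    A * pinv A hA * A = A ∧ pinv A hA * A * pinv A hA = pinv A hA ∧
      (A * pinv A hA)ᵀ = A * pinv A hA ∧ (pinv A hA * A)ᵀ = pinv A hA * A := by
  set U : Matrix n n ℝ := (hA.eigenvectorUnitary : Matrix n n ℝ) with hU
  set a := hA.eigenvalues with ha
  have hUU : star U * U = 1 := Unitary.coe_star_mul_self hA.eigenvectorUnitary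
  have hspec : A = U * Matrix.diagonal a * star U := by
    have h := hA.spectral_theorem
    rw [Unitary.conjStarAlgAut_apply] at h
    simpa using h
  have hP : pinv A hA = U * Matrix.diagonal (fun i => (a i)⁻¹) * star U := rfl
  have key : ∀ x y : n → ℝ, U * Matrix.diagonal x * star U * (U * Matrix.diagonal y * star U) =
      U * Matrix.diagonal (fun i => x i * y i) * star U := by
    intro x y
    calc U * Matrix.diagonal x * star U * (U * Matrix.diagonal y * star U)
        = U * Matrix.diagonal x * (star U * U) * Matrix.diagonal y * star U := by
          simp only [Matrix.mul_assoc]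
      _ = _ := by rw [hUU, Matrix.mul_one, Matrix.mul_assoc U, Matrix.diagonal_mul_diagonal]
  have hsym : ∀ x : n → ℝ, (U * Matrix.diagonal x * star U)ᵀ = U * Matrix.diagonal x * star U := by
    intro x
    have hs : star U = Uᵀ := by
      rw [Matrix.star_eq_conjTranspose, Matrix.conjTranspose_eq_transpose_of_trivial]
    rw [hs, Matrix.transpose_mul, Matrix.transpose_mul, Matrix.transpose_transpose,
      Matrix.diagonal_transpose, Matrix.mul_assoc]
  rw [hP]
  refine ⟨?_, ?_, ?_, ?_⟩
  · conv_lhs => rw [hspec]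
    conv_rhs => rw [hspec]
    rw [key, key]
    congr 3
    funext i
    by_cases h : a i = 0 <;> simp [h]
  · conv_lhs => rw [hspec]
    rw [key, key]
    congr 3
    funext i
    by_cases h : a i = 0 <;> simp [h]
  · conv_lhs => rw [hspec]
    conv_rhs => rw [hspec]
    rw [key, hsym]
  · conv_lhs => rw [hspec]
    conv_rhs => rw [hspec]
    rw [key, hsym]

/-! ### The power network and the planner's problem -/

/-- A power network with one generator per bus. -/
structure Network (N : Type*) [Fintype N] [DecidableEq N] where
  /-- the oriented lines -/
  edges : Finset (N × N)
  /-- at most one of the two orientations of a line is present (in particular: no loops) -/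
  oriented : ∀ j k, (j, k) ∈ edges → (k, j) ∉ edges
  connected : (SimpleGraph.fromRel fun j k => (j, k) ∈ edges).Connected
  /-- generator inertias -/
  M : N → ℝ
  M_pos : ∀ j, 0 < M j
  /-- damping coefficients -/
  D : N → ℝ
  D_pos : ∀ j, 0 < D j
  /-- line sensitivities -/
  B : edges → ℝ
  B_pos : ∀ e, 0 < B e
  /-- inelastic demand -/
  d : N → ℝ
  /-- lower thermal limits of the lines -/
  Flo : edges → ℝ
  /-- upper thermal limits of the lines -/
  Fup : edges → ℝ
  /-- generation cost functions -/
  J : N → ℝ → ℝ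
  J_strictConvex : ∀ j, StrictConvexOn ℝ Set.univ (J j)
  J_differentiable : ∀ j, Differentiable ℝ (J j)
  J_twice_differentiable : ∀ j, Differentiable ℝ (deriv (J j))

variable {N : Type*} [Fintype N] [DecidableEq N]

namespace Network

variable (G : Network N)

/-- The index set of the lines. -/
abbrev Line : Type _ := {e : N × N // e ∈ G.edges}

/-- The incidence matrix `C`. -/
def C : Matrix N G.Line ℝ :=
  Matrix.of fun j e => if e.1.1 = j then 1 else if e.1.2 = j then -1 else 0

/-- The weighted Laplacian `C B Cᵀ`. -/
def laplacian : Matrix N N ℝ := G.C * Matrix.diagonal G.B * (G.C)ᵀ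

theorem laplacian_isHermitian : G.laplacian.IsHermitian := by
  unfold laplacian
  rw [Matrix.IsHermitian, Matrix.conjTranspose_eq_transpose_of_trivial, Matrix.transpose_mul,
    Matrix.transpose_mul, Matrix.transpose_transpose, Matrix.diagonal_transpose, Matrix.mul_assoc]

/-- The power injection shift matrix `B Cᵀ L†`, with `L` the Laplacian. -/
def shift : Matrix G.Line N ℝ :=
  Matrix.diagonal G.B * (G.C)ᵀ * pinv G.laplacian G.laplacian_isHermitian

/-- The matrix `Hᵀ`: the shift matrix stacked on top of its negative. -/
def Ht : Matrix (G.Line ⊕ G.Line) N ℝ := Matrix.fromRows G.shift (-G.shift)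

/-- The stacked limit vector `F`. -/
def F : G.Line ⊕ G.Line → ℝ := Sum.elim G.Fup (fun e => -G.Flo e)

/-- Objective of the planner's problem. -/
def plannerCost (p ω : N → ℝ) : ℝ := ∑ j, G.J j (p j) + (1 / 2) * ∑ j, G.D j * ω j ^ 2

/-- Feasibility of `(p, q, ω, θ)` for the planner's problem. -/
def IsFeasible (p q ω : N → ℝ) (θ : G.Line → ℝ) : Prop :=
  q = p ∧ ∑ j, (q j - G.d j) = 0 ∧ (∀ e, (G.Ht *ᵥ (q - G.d)) e ≤ G.F e) ∧
    q - G.d - Matrix.diagonal G.D *ᵥ ω - G.C *ᵥ (Matrix.diagonal G.B *ᵥ θ) = 0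

/-- The planner's Lagrangian. -/
def lagrangian (p q ω : N → ℝ) (θ : G.Line → ℝ) (α : N → ℝ) (lam : ℝ)
    (η : G.Line ⊕ G.Line → ℝ) (ν : N → ℝ) : ℝ :=
  G.plannerCost p ω
    + ν ⬝ᵥ (q - G.d - Matrix.diagonal G.D *ᵥ ω - G.C *ᵥ (Matrix.diagonal G.B *ᵥ θ))
    + α ⬝ᵥ (q - p) - lam * ∑ j, (q j - G.d j) + η ⬝ᵥ (G.Ht *ᵥ (q - G.d) - G.F)

/-- Optimal primal-dual solution of the planner's problem: `(p, q, ω, θ)` is an optimal solution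
and `(α, λ, η, ν)`, with `η ≥ 0`, are dual optimizers, i.e. the dual function
`inf_{p, q, ω, θ} L` attains the optimal value at them. -/
def IsOptimalPrimalDual (p q ω : N → ℝ) (θ : G.Line → ℝ) (α : N → ℝ) (lam : ℝ)
    (η : G.Line ⊕ G.Line → ℝ) (ν : N → ℝ) : Prop :=
  G.IsFeasible p q ω θ ∧
  (∀ p' q' ω' θ', G.IsFeasible p' q' ω' θ' → G.plannerCost p ω ≤ G.plannerCost p' ω') ∧
  (∀ e, 0 ≤ η e) ∧
  (∀ p' q' ω' θ', G.plannerCost p ω ≤ G.lagrangian p' q' ω' θ' α lam η ν)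

/-! ### Coordinates -/

/-- Scalar primal variables: the entries of `p`, `q`, `ω`, `θ`, in this order. -/
abbrev PrimalIdx : Type _ := N ⊕ N ⊕ N ⊕ G.Line

/-- Scalar dual variables: the entries of `α`, `λ`, `η`, `ν`, in this order. -/
abbrev DualIdx : Type _ := N ⊕ Unit ⊕ (G.Line ⊕ G.Line) ⊕ N

abbrev ixp (j : N) : G.PrimalIdx := Sum.inl j
abbrev ixq (j : N) : G.PrimalIdx := Sum.inr (Sum.inl j)
abbrev ixω (j : N) : G.PrimalIdx := Sum.inr (Sum.inr (Sum.inl j))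
abbrev ixθ (e : G.Line) : G.PrimalIdx := Sum.inr (Sum.inr (Sum.inr e))
abbrev ixα (j : N) : G.DualIdx := Sum.inl j
abbrev ixlam : G.DualIdx := Sum.inr (Sum.inl ())
abbrev ixη (e : G.Line ⊕ G.Line) : G.DualIdx := Sum.inr (Sum.inr (Sum.inl e))
abbrev ixν (j : N) : G.DualIdx := Sum.inr (Sum.inr (Sum.inr j))

-- Shortcuts: all of these are the standard instances of sum types and subtypes.
instance : DecidableEq G.Line := inferInstance
instance : DecidableEq (G.Line ⊕ G.Line) := inferInstance
instance : DecidableEq G.PrimalIdx := inferInstance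
instance : DecidableEq G.DualIdx := inferInstance
instance : Fintype G.PrimalIdx := inferInstance
instance : Fintype G.DualIdx := inferInstance

/-- The coordinate is an entry of `η`. -/
def IsEta (k : G.DualIdx) : Prop := ∃ e, k = G.ixη e

/-- The Lagrangian in coordinates. -/
def lag (w : G.PrimalIdx → ℝ) (u : G.DualIdx → ℝ) : ℝ :=
  G.lagrangian (fun j => w (G.ixp j)) (fun j => w (G.ixq j)) (fun j => w (G.ixω j))
    (fun e => w (G.ixθ e)) (fun j => u (G.ixα j)) (u G.ixlam) (fun e => u (G.ixη e))
    (fun j => u (G.ixν j))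

/-- Optimal primal-dual solutions in coordinates. -/
def IsOptimal (w : G.PrimalIdx → ℝ) (u : G.DualIdx → ℝ) : Prop :=
  G.IsOptimalPrimalDual (fun j => w (G.ixp j)) (fun j => w (G.ixq j)) (fun j => w (G.ixω j))
    (fun e => w (G.ixθ e)) (fun j => u (G.ixα j)) (u G.ixlam) (fun e => u (G.ixη e))
    (fun j => u (G.ixν j))

end Network

/-! ### The grid-market-participant loop -/

/-- An aligned design of the loop: the choice, for each scalar variable of the planner's Lagrangian,
between the gradient update and elimination by optimization (best response), together with the time
constants of the gradient updates. The swing dynamics eliminate `ω` and update `θ` and `ν` by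
gradients, with time constants `B` and `M`; for all other variables the choice is free. -/
structure Design (G : Network N) where
  /-- the eliminated primal variables -/
  redP : Finset G.PrimalIdx
  /-- the eliminated dual variables -/
  redD : Finset G.DualIdx
  ω_mem : ∀ j, G.ixω j ∈ redP
  θ_notMem : ∀ e, G.ixθ e ∉ redP
  ν_notMem : ∀ j, G.ixν j ∉ redD
  /-- time constants of the primal variables -/
  τP : G.PrimalIdx → ℝ
  τP_pos : ∀ i, 0 < τP i
  τP_θ : ∀ e, τP (G.ixθ e) = G.B e
  /-- time constants of the dual variables -/
  τD : G.DualIdx → ℝ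
  τD_pos : ∀ k, 0 < τD k
  τD_ν : ∀ j, τD (G.ixν j) = G.M j

namespace Design

variable {G : Network N} (R : Design G)

/-- Values of `z`, the primal variables that are updated by gradients. -/
abbrev Z : Type _ := {i : G.PrimalIdx // i ∉ R.redP} → ℝ

/-- Values of `σ`, the dual variables that are updated by gradients. -/
abbrev Sg : Type _ := {k : G.DualIdx // k ∉ R.redD} → ℝ

/-- The state space of the loop: pairs `(z, σ)`. -/
abbrev State : Type _ := R.Z × R.Sg

/-- Values of the eliminated primal variables. -/
abbrev ElimP : Type _ := {i : G.PrimalIdx // i ∈ R.redP} → ℝ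

/-- Values of the eliminated dual variables, with nonnegative `η`-entries. -/
abbrev ElimD : Type _ :=
  {y : {k : G.DualIdx // k ∈ R.redD} → ℝ // ∀ k, G.IsEta k.1 → 0 ≤ y k}

/-- All primal variables, assembled from `z` and the eliminated ones. -/
def fullP (z : R.Z) (x : R.ElimP) : G.PrimalIdx → ℝ :=
  fun i => if h : i ∈ R.redP then x ⟨i, h⟩ else z ⟨i, h⟩

/-- All dual variables, assembled from `σ` and the eliminated ones. -/
def fullD (σ : R.Sg) (y : R.ElimD) : G.DualIdx → ℝ :=
  fun k => if h : k ∈ R.redD then y.1 ⟨k, h⟩ else σ ⟨k, h⟩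

/-- The reduced Lagrangian as an extended real: the min-max of the planner's Lagrangian over the
eliminated variables. -/
def reducedValue (z : R.Z) (σ : R.Sg) : EReal :=
  ⨅ x : R.ElimP, ⨆ y : R.ElimD, ((G.lag (R.fullP z x) (R.fullD σ y) : ℝ) : EReal)

/-- The finiteness assumption. -/
def Finiteness : Prop := ∀ z σ, R.reducedValue z σ ≠ ⊥ ∧ R.reducedValue z σ ≠ ⊤

/-- The reduced Lagrangian `L̂(z, σ)` as a real-valued function. -/
def Lhat (z : R.Z) (σ : R.Sg) : ℝ := (R.reducedValue z σ).toReal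

/-- Differentiability of `L̂`, so that the gradients in the loop exist. -/
def LhatDifferentiable : Prop := Differentiable ℝ fun s : R.State => R.Lhat s.1 s.2

/-- Partial derivative of `L̂` in the coordinate `i` of `z`. -/
def gradZ (s : R.State) : R.Z :=
  fun i => deriv (fun r : ℝ => R.Lhat (Function.update s.1 i r) s.2) (s.1 i)

/-- Partial derivative of `L̂` in the coordinate `k` of `σ`. -/
def gradσ (s : R.State) : R.Sg :=
  fun k => deriv (fun r : ℝ => R.Lhat s.1 (Function.update s.2 k r)) (s.2 k)

open Classical in
/-- The scalar projection `[y]⁺ᵤ`: equal to `y` if `y > 0` or `u > 0`, and to `0` otherwise. -/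
def proj (y u : ℝ) : ℝ := if 0 < y ∨ 0 < u then y else 0

open Classical in
/-- The right-hand side of the loop, solved for `(ż, σ̇)`. -/
def field (s : R.State) : R.State :=
  (fun i => (R.τP i.1)⁻¹ * -(R.gradZ s i),
   fun k => (R.τD k.1)⁻¹ *
    if G.IsEta k.1 then proj (R.gradσ s k) (s.2 k) else R.gradσ s k)

/-- The set `𝕀` of admissible initial points: the `η`-entries of `σ`, if any, are nonnegative. -/
def initialSet : Set R.State := {s | ∀ k, G.IsEta k.1 → 0 ≤ s.2 k}

/-- The set `𝔼` of equilibria (in `𝕀`) of the loop. -/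
def equilibria : Set R.State := {s | s ∈ R.initialSet ∧ R.field s = 0}

/-- Trajectories of the loop on `[0, ∞)` that start in `𝕀`, in the sense of Caratheodory: locally
absolutely continuous functions that satisfy the differential equation at almost every time. -/
def IsTrajectory (s : ℝ → R.State) : Prop :=
  s 0 ∈ R.initialSet ∧
  (∀ T : ℝ, 0 ≤ T → AbsolutelyContinuousOnInterval s 0 T) ∧
  ∀ᵐ t ∂(MeasureTheory.volume.restrict (Set.Ici (0 : ℝ))), HasDerivAt s (R.field (s t)) t

/-- The observability assumption. -/
def Observability : Prop :=
  ∀ sEq ∈ R.equilibria, ∀ s : ℝ → R.State, R.IsTrajectory s →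
    (∀ t, 0 ≤ t → R.Lhat sEq.1 (s t).2 = R.Lhat sEq.1 sEq.2) →
    (∀ t, 0 ≤ t → R.Lhat (s t).1 sEq.2 = R.Lhat sEq.1 sEq.2) →
    ∀ t, 0 ≤ t → HasDerivWithinAt s 0 (Set.Ici 0) t

/-- A set `A` of states is globally asymptotically stable on `𝕀`: it is nonempty, it is stable in
the sense of Lyapunov, and it attracts all trajectories that start in `𝕀`. -/
def GloballyAsymptoticallyStable (A : Set R.State) : Prop :=
  A.Nonempty ∧
  (∀ ε > 0, ∃ δ > 0, ∀ s : ℝ → R.State, R.IsTrajectory s →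
    Metric.infDist (s 0) A < δ → ∀ t, 0 ≤ t → Metric.infDist (s t) A < ε) ∧
  ∀ s : ℝ → R.State, R.IsTrajectory s →
    Filter.Tendsto (fun t => Metric.infDist (s t) A) Filter.atTop (𝓝 0)

/-- The state `(z, σ)` corresponds to an optimal primal-dual solution of the planner's problem: it
is completed to one by suitable values of the eliminated variables. -/
def CorrespondsToOptimum (s : R.State) : Prop :=
  ∃ (x : R.ElimP) (y : R.ElimD), G.IsOptimal (R.fullP s.1 x) (R.fullD s.2 y)

end Design

end GridMarket

end

noncomputable section

namespace GridMarket

open MeasureTheory Set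

/-! The loop is a projected saddle flow of a convex-concave function. The proof combines duality for
the planner's problem with a contraction argument for the flow.

Duality. The Lagrangian is the cost plus multipliers times affine residuals. Maximizing over
eliminated multipliers enforces their constraints, so `L̂(z, σ)` is the infimum of `partialLag` over
points `w` that extend `z` and satisfy the eliminated constraints (`Lhat_le`, `le_Lhat`). Hence `L̂`
is convex in `z` and concave in `σ`. Since all constraints are affine, Farkas' lemma gives
multipliers without a constraint qualification (`exists_multipliers`), so the planner's problem has
a primal-dual optimum, and its dynamic entries form a saddle point of `L̂` on `𝕀`. Conversely, every
saddle point of `L̂` extends to an optimum: the eliminated multipliers come from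
`exists_multipliers`, the eliminated primal variables from separating a point from the closed convex
set `attainable`. Closedness holds because residual bounds together with the fixed `θ` bound all
primal variables.

Dynamics. In the inner product weighted by the time constants, the field satisfies the variational
inequality `⟨field s, s - v⟩ ≤ L̂(v₁, s₂) - L̂(s₁, v₂)` for `v ∈ 𝕀`, and suitable solutions of this
inequality are values of the field (`wip_field_le`, `eq_field_of_wip_le`). Equilibria are therefore
exactly the saddle points, and the weighted distance between two trajectories never increases.
Boundedness and Lyapunov stability follow at once.

Convergence is a LaSalle argument. The projection makes the field discontinuous, so limits are taken
in the integrated inequality, which involves only the continuous function `L̂`. Shifts of a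
trajectory along times at which it converges have a limit trajectory; on it the distance to each
equilibrium is constant, so the saddle gap vanishes, observability makes it stationary, and it meets
an equilibrium. The distance of the original trajectory to this equilibrium is monotone with limit
`0`. -/

/-! ### Farkas' lemma -/

/-- Farkas' lemma for finitely many linear functionals on a real vector space. -/
theorem farkas {V ι : Type*} [AddCommGroup V] [Module ℝ V] [DecidableEq ι] (s : Finset ι)
    (a : ι → V →ₗ[ℝ] ℝ) (b : V →ₗ[ℝ] ℝ)
    (h : ∀ v, (∀ i ∈ s, a i v ≤ 0) → b v ≤ 0) :
    ∃ u : ι → ℝ, (∀ i, 0 ≤ u i) ∧ ∀ v, b v = ∑ i ∈ s, u i * a i v := by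
  induction s using Finset.induction_on generalizing a b with
  | empty =>
    refine ⟨0, fun _ => le_rfl, fun v => ?_⟩
    have h1 := h v (by simp)
    have h2 := h (-v) (by simp)
    rw [map_neg] at h2
    simp only [Finset.sum_empty]
    linarith
  | insert k s hk ih =>
    have hne : ∀ i ∈ s, i ≠ k := fun i hi e => hk (e ▸ hi)
    -- If the constraint `k` is redundant, it gets multiplier zero. Otherwise there is `v₀` with `b
    -- v₀ > 0` that violates only `k`.
    by_cases hs : ∀ v, (∀ i ∈ s, a i v ≤ 0) → b v ≤ 0
    · obtain ⟨u, hu, hb⟩ := ih a b hs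
      refine ⟨fun i => if i = k then 0 else u i, fun i => ?_, fun v => ?_⟩
      · show 0 ≤ if i = k then 0 else u i
        split_ifs
        exacts [le_rfl, hu i]
      · rw [Finset.sum_insert hk, hb v]
        simp only [if_true, zero_mul, zero_add]
        refine Finset.sum_congr rfl fun i hi => ?_
        rw [if_neg (hne i hi)]
    · push Not at hs
      obtain ⟨v₀, hv₀, hb₀⟩ := hs
      have hk₀ : 0 < a k v₀ := by
        by_contra hc
        push Not at hc
        have := h v₀ (by simpa using ⟨hc, hv₀⟩)
        linarith
      set c := a k v₀ with hc
      -- All functionals are composed with the projection along `v₀` onto the kernel of `a k`, which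
      -- removes the constraint `k`.
      obtain ⟨u, hu, hb⟩ := ih (fun i => a i - (a i v₀ / c) • a k) (b - (b v₀ / c) • a k) (by
        intro v hv
        have := h (v - (a k v / c) • v₀) (by
          intro i hi
          rcases Finset.mem_insert.1 hi with rfl | hi
          · rw [map_sub, map_smul, smul_eq_mul, ← hc, div_mul_cancel₀ _ hk₀.ne', sub_self]
          · have := hv i hi
            simp only [LinearMap.sub_apply, LinearMap.smul_apply, smul_eq_mul] at this
            rw [map_sub, map_smul, smul_eq_mul]
            calc _ = a i v - a i v₀ / c * a k v := by ring
              _ ≤ 0 := this)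
        rw [map_sub, map_smul, smul_eq_mul] at this
        simp only [LinearMap.sub_apply, LinearMap.smul_apply, smul_eq_mul]
        calc _ = b v - a k v / c * b v₀ := by ring
          _ ≤ 0 := this)
      have hsum : ∑ i ∈ s, u i * a i v₀ ≤ 0 :=
        Finset.sum_nonpos fun i hi => mul_nonpos_of_nonneg_of_nonpos (hu i) (hv₀ i hi)
      -- The multiplier of `k` is forced by evaluation at `v₀`. It is nonnegative because `b v₀ > 0`
      -- while the sum is nonpositive.
      refine ⟨fun i => if i = k then (b v₀ - ∑ i ∈ s, u i * a i v₀) / c else u i,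
        fun i => ?_, fun v => ?_⟩
      · show 0 ≤ if i = k then (b v₀ - ∑ i ∈ s, u i * a i v₀) / c else u i
        split_ifs
        exacts [div_nonneg (by linarith) hk₀.le, hu i]
      · have hbv := hb v
        simp only [LinearMap.sub_apply, LinearMap.smul_apply, smul_eq_mul] at hbv
        rw [Finset.sum_insert hk]
        have hs : ∑ i ∈ s, (if i = k then (b v₀ - ∑ i ∈ s, u i * a i v₀) / c else u i) * a i v =
            ∑ i ∈ s, u i * a i v :=
          Finset.sum_congr rfl fun i hi => by rw [if_neg (hne i hi)]
        simp only [if_true, hs]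
        have : ∑ i ∈ s, u i * (a i v - a i v₀ / c * a k v) =
            ∑ i ∈ s, u i * a i v - (∑ i ∈ s, u i * a i v₀) / c * a k v := by
          rw [Finset.sum_div, Finset.sum_mul, ← Finset.sum_sub_distrib]
          exact Finset.sum_congr rfl fun i _ => by ring
        rw [this] at hbv
        linear_combination hbv

/-! ### The gradient inequality -/

theorem _root_.ConvexOn.add_hasFDerivAt_le {E : Type*} [NormedAddCommGroup E] [NormedSpace ℝ E]
    {f : E → ℝ} {f' : E →L[ℝ] ℝ} {x : E} (hf : ConvexOn ℝ univ f) (h : HasFDerivAt f f' x)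
    (y : E) : f x + f' (y - x) ≤ f y := by
  have hg : ConvexOn ℝ univ (f ∘ AffineMap.lineMap (k := ℝ) x y) := by
    have := hf.comp_affineMap (AffineMap.lineMap (k := ℝ) x y)
    simpa using this
  have hd : HasDerivAt (f ∘ AffineMap.lineMap (k := ℝ) x y) (f' (y - x)) 0 := by
    have h0 : HasFDerivAt f f' (AffineMap.lineMap (k := ℝ) x y 0) := by simpa using h
    exact h0.comp_hasDerivAt (0 : ℝ) AffineMap.hasDerivAt_lineMap
  have := hg.le_slope_of_hasDerivAt (mem_univ (0 : ℝ)) (mem_univ (1 : ℝ)) one_pos hd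
  rw [slope_def_field] at this
  simp only [Function.comp_apply, AffineMap.lineMap_apply_one, AffineMap.lineMap_apply_zero,
    sub_zero, div_one] at this
  linarith

theorem _root_.ConcaveOn.le_add_hasFDerivAt {E : Type*} [NormedAddCommGroup E] [NormedSpace ℝ E]
    {f : E → ℝ} {f' : E →L[ℝ] ℝ} {x : E} (hf : ConcaveOn ℝ univ f) (h : HasFDerivAt f f' x)
    (y : E) : f y ≤ f x + f' (y - x) := by
  have := hf.neg.add_hasFDerivAt_le h.neg y
  simp only [Pi.neg_apply, _root_.neg_apply] at this
  linarith

/-! ### Absolutely continuous functions -/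

theorem _root_.AbsolutelyContinuousOnInterval.lipschitzWith_comp {X Y : Type*}
    [PseudoMetricSpace X] [PseudoMetricSpace Y] {K : NNReal} {g : X → Y} {f : ℝ → X} {a b : ℝ}
    (hg : LipschitzWith K g) (hf : AbsolutelyContinuousOnInterval f a b) :
    AbsolutelyContinuousOnInterval (fun t => g (f t)) a b := by
  have h0 : Filter.Tendsto (fun E : ℕ × (ℕ → ℝ × ℝ) =>
      (K : ℝ) * ∑ i ∈ Finset.range E.1, dist (f (E.2 i).1) (f (E.2 i).2))
      (AbsolutelyContinuousOnInterval.totalLengthFilter ⊓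
        Filter.principal (AbsolutelyContinuousOnInterval.disjWithin a b)) (𝓝 0) := by
    have := Filter.Tendsto.const_mul (K : ℝ) hf
    rwa [mul_zero] at this
  refine squeeze_zero (fun E => Finset.sum_nonneg fun _ _ => dist_nonneg) (fun E => ?_) h0
  rw [Finset.mul_sum]
  exact Finset.sum_le_sum fun i _ => hg.dist_le_mul _ _

theorem _root_.AbsolutelyContinuousOnInterval.finset_sum {ι F : Type*} [SeminormedAddCommGroup F]
    {f : ι → ℝ → F} {a b : ℝ} (s : Finset ι)
    (h : ∀ i ∈ s, AbsolutelyContinuousOnInterval (f i) a b) :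
    AbsolutelyContinuousOnInterval (fun t => ∑ i ∈ s, f i t) a b := by
  classical
  induction s using Finset.induction_on with
  | empty =>
    simp only [Finset.sum_empty]
    exact ((LipschitzWith.const (0 : F)).lipschitzOnWith).absolutelyContinuousOnInterval
  | insert k s hk ih =>
    simp only [Finset.sum_insert hk]
    exact (h k (Finset.mem_insert_self _ _)).add
      (ih fun i hi => h i (Finset.mem_insert_of_mem hi))

theorem _root_.AbsolutelyContinuousOnInterval.sub_le_integral {f g : ℝ → ℝ} {a b : ℝ}
    (hab : a ≤ b) (hf : AbsolutelyContinuousOnInterval f a b)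
    (hg : IntervalIntegrable g volume a b)
    (h : ∀ᵐ t, t ∈ Icc a b → deriv f t ≤ g t) : f b - f a ≤ ∫ t in a..b, g t := by
  rw [← hf.integral_deriv_eq_sub]
  refine intervalIntegral.integral_mono_ae_restrict hab hf.intervalIntegrable_deriv hg ?_
  exact (ae_restrict_iff' measurableSet_Icc).2 h

theorem _root_.AbsolutelyContinuousOnInterval.le_of_deriv_nonpos {f : ℝ → ℝ} {a b : ℝ}
    (hab : a ≤ b) (hf : AbsolutelyContinuousOnInterval f a b)
    (h : ∀ᵐ t, t ∈ Icc a b → deriv f t ≤ 0) : f b ≤ f a := by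
  have := hf.sub_le_integral (g := fun _ => 0) hab (by simp) h
  simp only [intervalIntegral.integral_zero] at this
  linarith

/-- An absolutely continuous function with nonnegative initial value that does not decrease while
it is negative remains nonnegative. -/
theorem _root_.AbsolutelyContinuousOnInterval.nonneg_of_deriv_nonneg {f : ℝ → ℝ} {a b : ℝ}
    (hab : a ≤ b) (hf : AbsolutelyContinuousOnInterval f a b) (ha : 0 ≤ f a)
    (h : ∀ᵐ t, t ∈ Icc a b → f t ≤ 0 → 0 ≤ deriv f t) : 0 ≤ f b := by
  by_contra hb
  push Not at hb
  have hcont : ContinuousOn f (Icc a b) := by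
    have := hf.continuousOn
    rwa [uIcc_of_le hab] at this
  -- The supremum of `S` is the last time at which `f` is nonnegative. After it `f` is negative,
  -- hence nondecreasing, which excludes `f b < 0`.
  set S := Icc a b ∩ f ⁻¹' (Ici 0) with hS
  have hScl : IsClosed S := hcont.preimage_isClosed_of_isClosed isClosed_Icc isClosed_Ici
  have hSne : S.Nonempty := ⟨a, ⟨le_rfl, hab⟩, ha⟩
  have hSb : BddAbove S := ⟨b, fun t ht => ht.1.2⟩
  set c := sSup S with hc
  have hcS : c ∈ S := hScl.csSup_mem hSne hSb
  have hneg : ∀ t ∈ Ioc c b, f t < 0 := by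
    intro t ht
    by_contra hft
    push Not at hft
    exact absurd (le_csSup hSb ⟨⟨hcS.1.1.trans ht.1.le, ht.2⟩, hft⟩) (not_le.2 ht.1)
  have hmono : AbsolutelyContinuousOnInterval f c b := by
    refine hf.mono ?_
    rw [uIcc_of_le hcS.1.2, uIcc_of_le hab]
    exact Icc_subset_Icc_left hcS.1.1
  have key := hmono.neg.le_of_deriv_nonpos hcS.1.2 (by
    have hne : ∀ᵐ t : ℝ, t ≠ c := by simp [ae_iff, measure_singleton]
    filter_upwards [h, hne] with t ht htc htI
    have h1 : c < t := lt_of_le_of_ne htI.1 (Ne.symm htc)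
    have := ht ⟨hcS.1.1.trans htI.1, htI.2⟩ (hneg t ⟨h1, htI.2⟩).le
    rw [deriv.neg]
    linarith)
  have h0 : 0 ≤ f c := hcS.2
  simp only [Pi.neg_apply] at key
  linarith

variable {N : Type*} [Fintype N] [DecidableEq N]

namespace Network

variable (G : Network N)

/-! ### The Lagrangian as cost plus multipliers times constraint residuals -/

/-- Linear part of the constraint functions of the planner's problem. -/
def residualLin : (G.PrimalIdx → ℝ) →ₗ[ℝ] (G.DualIdx → ℝ) where
  toFun w := Sum.elim (fun j => w (G.ixq j) - w (G.ixp j)) (Sum.elim (fun _ => -∑ j, w (G.ixq j))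
    (Sum.elim (G.Ht *ᵥ fun j => w (G.ixq j))
      ((fun j => w (G.ixq j)) - Matrix.diagonal G.D *ᵥ (fun j => w (G.ixω j))
        - G.C *ᵥ (Matrix.diagonal G.B *ᵥ fun e => w (G.ixθ e)))))
  map_add' w w' := by
    have h1 : (fun j => (w + w') (G.ixq j)) = (fun j => w (G.ixq j)) + fun j => w' (G.ixq j) := rfl
    have h2 : (fun j => (w + w') (G.ixω j)) = (fun j => w (G.ixω j)) + fun j => w' (G.ixω j) := rfl
    have h3 : (fun e => (w + w') (G.ixθ e)) = (fun e => w (G.ixθ e)) + fun e => w' (G.ixθ e) := rfl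
    rw [h1, h2, h3]
    simp only [Matrix.mulVec_add]
    ext k
    rcases k with j | _ | e | j <;>
      simp only [Sum.elim_inl, Sum.elim_inr, Pi.add_apply, Pi.sub_apply, Finset.sum_add_distrib] <;>
      ring
  map_smul' c w := by
    have h1 : (fun j => (c • w) (G.ixq j)) = c • (fun j => w (G.ixq j)) := rfl
    have h2 : (fun j => (c • w) (G.ixω j)) = c • (fun j => w (G.ixω j)) := rfl
    have h3 : (fun e => (c • w) (G.ixθ e)) = c • (fun e => w (G.ixθ e)) := rfl
    rw [h1, h2, h3]
    simp only [Matrix.mulVec_smul]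
    ext k
    rcases k with j | _ | e | j <;>
      simp only [Sum.elim_inl, Sum.elim_inr, Pi.smul_apply, Pi.sub_apply, smul_eq_mul,
        RingHom.id_apply, ← Finset.mul_sum] <;>
      ring

/-- The constraint functions of the planner's problem, in the order of their multipliers. -/
def residual (w : G.PrimalIdx → ℝ) : G.DualIdx → ℝ :=
  G.residualLin w + Sum.elim (fun _ => 0) (Sum.elim (fun _ => ∑ j, G.d j)
    (Sum.elim (-(G.Ht *ᵥ G.d) - G.F) (-G.d)))

/-- The objective of the planner's problem in coordinates. -/
def cost (w : G.PrimalIdx → ℝ) : ℝ :=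
  G.plannerCost (fun j => w (G.ixp j)) (fun j => w (G.ixω j))

theorem residual_ixα (w : G.PrimalIdx → ℝ) (j : N) :
    G.residual w (G.ixα j) = w (G.ixq j) - w (G.ixp j) := by
  simp [residual, residualLin]

theorem residual_ixlam (w : G.PrimalIdx → ℝ) :
    G.residual w G.ixlam = -∑ j, (w (G.ixq j) - G.d j) := by
  simp [residual, residualLin]
  ring

theorem residual_ixη (w : G.PrimalIdx → ℝ) (e : G.Line ⊕ G.Line) :
    G.residual w (G.ixη e) = (G.Ht *ᵥ ((fun j => w (G.ixq j)) - G.d)) e - G.F e := by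
  simp [residual, residualLin, Matrix.mulVec_sub]
  ring

theorem residual_ixν (w : G.PrimalIdx → ℝ) (j : N) :
    G.residual w (G.ixν j) = ((fun j => w (G.ixq j)) - G.d
      - Matrix.diagonal G.D *ᵥ (fun j => w (G.ixω j))
      - G.C *ᵥ (Matrix.diagonal G.B *ᵥ fun e => w (G.ixθ e))) j := by
  simp [residual, residualLin]
  ring

theorem lag_eq (w : G.PrimalIdx → ℝ) (u : G.DualIdx → ℝ) :
    G.lag w u = G.cost w + ∑ k, u k * G.residual w k := by
  rw [Fintype.sum_sum_type, Fintype.sum_sum_type, Fintype.sum_sum_type (α₁ := G.Line ⊕ G.Line)]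
  have hα : ∀ j, G.residual w (Sum.inl j) = w (G.ixq j) - w (G.ixp j) := G.residual_ixα w
  have hl := G.residual_ixlam w
  have hη := G.residual_ixη w
  have hν := G.residual_ixν w
  simp only [ixη, ixν, ixlam] at hl hη hν
  simp only [hα, hη, hν, Finset.univ_unique, PUnit.default_eq_unit, Finset.sum_singleton, hl]
  simp only [lag, lagrangian, cost, dotProduct]
  simp only [Pi.sub_apply]
  ring

theorem residual_sub (w w' : G.PrimalIdx → ℝ) :
    G.residual w - G.residual w' = G.residualLin (w - w') := by
  rw [map_sub, residual, residual]
  abel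

theorem residual_combo (w w' : G.PrimalIdx → ℝ) {a b : ℝ} (hab : a + b = 1) (k : G.DualIdx) :
    G.residual (a • w + b • w') k = a * G.residual w k + b * G.residual w' k := by
  have h0 : ∀ v, G.residual v k = G.residualLin v k + G.residual 0 k := by
    intro v
    simp [residual]
  rw [h0, h0 w, h0 w', map_add, map_smul, map_smul]
  simp only [Pi.add_apply, Pi.smul_apply, smul_eq_mul]
  linear_combination (-(G.residual 0 k)) * hab

theorem continuous_residual : Continuous G.residual :=
  (LinearMap.continuous_of_finiteDimensional G.residualLin).add continuous_const

theorem isEta_ixη (e : G.Line ⊕ G.Line) : G.IsEta (G.ixη e) := ⟨e, rfl⟩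
theorem not_isEta_ixα (j : N) : ¬ G.IsEta (G.ixα j) := by rintro ⟨e, h⟩; simp at h
theorem not_isEta_ixlam : ¬ G.IsEta G.ixlam := by rintro ⟨e, h⟩; simp at h
theorem not_isEta_ixν (j : N) : ¬ G.IsEta (G.ixν j) := by rintro ⟨e, h⟩; simp at h

/-- The point `w` satisfies the constraints whose multipliers are in `S`. -/
def Satisfies (S : Finset G.DualIdx) (w : G.PrimalIdx → ℝ) : Prop :=
  ∀ k ∈ S, (G.IsEta k → G.residual w k ≤ 0) ∧ (¬ G.IsEta k → G.residual w k = 0)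

variable {G}

theorem Satisfies.mono {S T : Finset G.DualIdx} {w : G.PrimalIdx → ℝ} (h : G.Satisfies T w)
    (hST : S ⊆ T) : G.Satisfies S w := fun k hk => h k (hST hk)

theorem Satisfies.mul_nonpos {S : Finset G.DualIdx} {w : G.PrimalIdx → ℝ}
    (h : G.Satisfies S w) {k : G.DualIdx} (hk : k ∈ S) {r : ℝ} (hr : G.IsEta k → 0 ≤ r) :
    r * G.residual w k ≤ 0 := by
  by_cases he : G.IsEta k
  · exact mul_nonpos_of_nonneg_of_nonpos (hr he) ((h k hk).1 he)
  · rw [(h k hk).2 he, mul_zero]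

theorem Satisfies.combo {S : Finset G.DualIdx} {w w' : G.PrimalIdx → ℝ} (h : G.Satisfies S w)
    (h' : G.Satisfies S w') {a b : ℝ} (ha : 0 ≤ a) (hb : 0 ≤ b) (hab : a + b = 1) :
    G.Satisfies S (a • w + b • w') := by
  intro k hk
  rw [G.residual_combo w w' hab]
  refine ⟨fun he => ?_, fun he => ?_⟩
  · have h1 := mul_nonpos_of_nonneg_of_nonpos ha ((h k hk).1 he)
    have h2 := mul_nonpos_of_nonneg_of_nonpos hb ((h' k hk).1 he)
    linarith
  · rw [(h k hk).2 he, (h' k hk).2 he]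
    ring

variable (G)

theorem satisfies_univ_iff (w : G.PrimalIdx → ℝ) :
    G.Satisfies Finset.univ w ↔ G.IsFeasible (fun j => w (G.ixp j)) (fun j => w (G.ixq j))
      (fun j => w (G.ixω j)) (fun e => w (G.ixθ e)) := by
  constructor
  · intro h
    refine ⟨?_, ?_, ?_, ?_⟩
    · funext j
      have := (h (G.ixα j) (Finset.mem_univ _)).2 (G.not_isEta_ixα j)
      rw [residual_ixα] at this
      linarith
    · have := (h G.ixlam (Finset.mem_univ _)).2 G.not_isEta_ixlam
      rw [residual_ixlam] at this
      linarith
    · intro e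
      have := (h (G.ixη e) (Finset.mem_univ _)).1 (G.isEta_ixη e)
      rw [residual_ixη] at this
      linarith
    · funext j
      have := (h (G.ixν j) (Finset.mem_univ _)).2 (G.not_isEta_ixν j)
      rw [residual_ixν] at this
      exact this
  · rintro ⟨h1, h2, h3, h4⟩ k -
    rcases k with j | _ | e | j
    · refine ⟨fun h => absurd h (G.not_isEta_ixα j), fun _ => ?_⟩
      have := congrFun h1 j
      exact (G.residual_ixα w j).trans (by simpa [sub_eq_zero] using this)
    · refine ⟨fun h => absurd h G.not_isEta_ixlam, fun _ => ?_⟩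
      exact (G.residual_ixlam w).trans (neg_eq_zero.2 h2)
    · refine ⟨fun _ => ?_, fun h => absurd (G.isEta_ixη e) h⟩
      have := G.residual_ixη w e
      have h3 := h3 e
      exact this.trans_le (by linarith)
    · refine ⟨fun h => absurd h (G.not_isEta_ixν j), fun _ => ?_⟩
      exact (G.residual_ixν w j).trans (congrFun h4 j)

/-- Weak duality turns a lower bound on the Lagrangian into optimality. -/
theorem isOptimal_of_forall_le {w : G.PrimalIdx → ℝ} {u : G.DualIdx → ℝ}
    (hw : G.Satisfies Finset.univ w) (hu : ∀ k, G.IsEta k → 0 ≤ u k)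
    (h : ∀ w', G.cost w ≤ G.lag w' u) : G.IsOptimal w u := by
  have key : ∀ p q ω θ, G.plannerCost (fun j => w (G.ixp j)) (fun j => w (G.ixω j)) ≤
      G.lagrangian p q ω θ (fun j => u (G.ixα j)) (u G.ixlam) (fun e => u (G.ixη e))
        (fun j => u (G.ixν j)) := fun p q ω θ =>
    h (Sum.elim p (Sum.elim q (Sum.elim ω θ)))
  refine ⟨(G.satisfies_univ_iff w).1 hw, fun p q ω θ hf => ?_, fun e => hu _ (G.isEta_ixη e), key⟩
  set w' : G.PrimalIdx → ℝ := Sum.elim p (Sum.elim q (Sum.elim ω θ)) with hw'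
  have hs : G.Satisfies Finset.univ w' := (G.satisfies_univ_iff w').2 hf
  have h1 := h w'
  rw [lag_eq] at h1
  have h2 : ∑ k, u k * G.residual w' k ≤ 0 :=
    Finset.sum_nonpos fun k _ => hs.mul_nonpos (Finset.mem_univ k) (hu k)
  have h3 : G.cost w ≤ G.cost w' := by linarith
  exact h3

/-! ### The cost function -/

theorem convexOn_cost : ConvexOn ℝ univ G.cost := by
  have h1 : ∀ j, ConvexOn ℝ univ fun w : G.PrimalIdx → ℝ => G.J j (w (G.ixp j)) := fun j =>
    (G.J_strictConvex j).convexOn.comp_linearMap (LinearMap.proj (R := ℝ) (φ := fun _ => ℝ) (G.ixp j))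
  have h2 : ∀ j, ConvexOn ℝ univ fun w : G.PrimalIdx → ℝ => G.D j * w (G.ixω j) ^ 2 := fun j =>
    ((even_two.convexOn_pow (𝕜 := ℝ)).comp_linearMap
      (LinearMap.proj (R := ℝ) (φ := fun _ => ℝ) (G.ixω j))).smul (G.D_pos j).le
  have h3 : ∀ s : Finset N, ConvexOn ℝ univ
      fun w : G.PrimalIdx → ℝ => ∑ j ∈ s, G.J j (w (G.ixp j)) := by
    intro s
    induction s using Finset.induction_on with
    | empty => simpa using convexOn_const (𝕜 := ℝ) (0 : ℝ) convex_univ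
    | insert k s hk ih =>
      simp only [Finset.sum_insert hk]
      exact (h1 k).add ih
  have h4 : ∀ s : Finset N, ConvexOn ℝ univ
      fun w : G.PrimalIdx → ℝ => ∑ j ∈ s, G.D j * w (G.ixω j) ^ 2 := by
    intro s
    induction s using Finset.induction_on with
    | empty => simpa using convexOn_const (𝕜 := ℝ) (0 : ℝ) convex_univ
    | insert k s hk ih =>
      simp only [Finset.sum_insert hk]
      exact (h2 k).add ih
  exact (h3 Finset.univ).add ((h4 Finset.univ).smul (by norm_num : (0 : ℝ) ≤ 1 / 2))

theorem differentiable_cost : Differentiable ℝ G.cost := by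
  have h1 : ∀ j, Differentiable ℝ fun w : G.PrimalIdx → ℝ => G.J j (w (G.ixp j)) := fun j =>
    (G.J_differentiable j).comp (differentiable_apply _)
  unfold cost plannerCost
  fun_prop

/-! ### The weighted Laplacian -/

theorem laplacian_mulVec (y : N → ℝ) :
    G.laplacian *ᵥ y = G.C *ᵥ (Matrix.diagonal G.B *ᵥ (G.Cᵀ *ᵥ y)) := by
  simp only [laplacian, Matrix.mulVec_mulVec, Matrix.mul_assoc]

theorem transpose_C_mulVec (y : N → ℝ) (e : G.Line) :
    (G.Cᵀ *ᵥ y) e = y e.1.1 - y e.1.2 := by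
  have hne : e.1.1 ≠ e.1.2 := by
    intro h
    have h1 : (e.1.1, e.1.2) ∈ G.edges := e.2
    have h2 := G.oriented _ _ h1
    rw [← h] at h1 h2
    exact h2 h1
  simp only [Matrix.mulVec, dotProduct, Matrix.transpose_apply, C, Matrix.of_apply]
  rw [Finset.sum_congr rfl (g := fun j => (if e.1.1 = j then y j else 0) -
    (if e.1.2 = j then y j else 0))]
  · rw [Finset.sum_sub_distrib]
    simp
  · intro j _
    by_cases h1 : e.1.1 = j
    · have h2 : e.1.2 ≠ j := fun h => hne (h1.trans h.symm)
      simp [h1, h2]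
    · by_cases h2 : e.1.2 = j <;> simp [h1, h2]

theorem transpose_C_mulVec_const (c : ℝ) : G.Cᵀ *ᵥ (fun _ => c) = 0 := by
  funext e
  rw [transpose_C_mulVec]
  simp

theorem eq_of_transpose_C_mulVec_eq_zero {y : N → ℝ} (h : G.Cᵀ *ᵥ y = 0) (j k : N) :
    y j = y k := by
  have hadj : ∀ a b, (SimpleGraph.fromRel fun j k => (j, k) ∈ G.edges).Adj a b → y a = y b := by
    intro a b hab
    rw [SimpleGraph.fromRel_adj] at hab
    rcases hab.2 with h1 | h1
    · have := congrFun h ⟨(a, b), h1⟩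
      rw [transpose_C_mulVec] at this
      exact sub_eq_zero.1 this
    · have := congrFun h ⟨(b, a), h1⟩
      rw [transpose_C_mulVec] at this
      exact (sub_eq_zero.1 this).symm
  obtain ⟨p⟩ := G.connected.preconnected j k
  induction p with
  | nil => rfl
  | cons hab _ ih => exact (hadj _ _ hab).trans ih

/-- The quadratic form of the Laplacian is the sum of squares of `Cᵀ y` with the positive weights
`B`. -/
theorem transpose_C_mulVec_eq_zero {y : N → ℝ} (h : G.laplacian *ᵥ y = 0) : G.Cᵀ *ᵥ y = 0 := by
  have h1 : y ⬝ᵥ (G.laplacian *ᵥ y) = ∑ e, G.B e * ((G.Cᵀ *ᵥ y) e) ^ 2 := by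
    rw [laplacian_mulVec, Matrix.dotProduct_mulVec, ← Matrix.mulVec_transpose]
    simp only [dotProduct, Matrix.mulVec_diagonal]
    exact Finset.sum_congr rfl fun e _ => by ring
  rw [h, dotProduct_zero] at h1
  have h2 := (Finset.sum_eq_zero_iff_of_nonneg
    (fun e _ => mul_nonneg (G.B_pos e).le (sq_nonneg _))).1 h1.symm
  funext e
  have := h2 e (Finset.mem_univ e)
  rcases mul_eq_zero.1 this with h3 | h3
  · exact absurd h3 (G.B_pos e).ne'
  · simpa using h3

/-- By the Penrose equations the Laplacian annihilates the defect `r - L L† r`, which is then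
constant by connectedness. Its entries sum to zero, so it vanishes. -/
theorem laplacian_mulVec_pinv_mulVec {r : N → ℝ} (hr : ∑ j, r j = 0) :
    G.laplacian *ᵥ (pinv G.laplacian G.laplacian_isHermitian *ᵥ r) = r := by
  obtain ⟨h1, -, h3, -⟩ := pinv_penrose G.laplacian G.laplacian_isHermitian
  have hT : (G.laplacian)ᵀ = G.laplacian := by
    have := G.laplacian_isHermitian
    rwa [Matrix.IsHermitian, Matrix.conjTranspose_eq_transpose_of_trivial] at this
  set L := G.laplacian with hL
  set P := pinv L G.laplacian_isHermitian with hP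
  rw [Matrix.mulVec_mulVec]
  set y := r - (L * P) *ᵥ r with hy
  have hLy : L *ᵥ y = 0 := by
    have h4 : L * (L * P) = L := by
      have := congrArg Matrix.transpose h1
      rwa [Matrix.transpose_mul, h3, hT] at this
    rw [hy, Matrix.mulVec_sub, Matrix.mulVec_mulVec, h4, sub_self]
  have hcon := G.eq_of_transpose_C_mulVec_eq_zero (G.transpose_C_mulVec_eq_zero hLy)
  have hL1 : (fun _ => (1 : ℝ)) ᵥ* L = 0 := by
    rw [← Matrix.mulVec_transpose, hT, hL, laplacian_mulVec, transpose_C_mulVec_const]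
    simp
  have hsum : ∑ j, y j = 0 := by
    have h5 : (fun _ => (1 : ℝ)) ⬝ᵥ ((L * P) *ᵥ r) = 0 := by
      rw [← Matrix.mulVec_mulVec, Matrix.dotProduct_mulVec, hL1, zero_dotProduct]
    simp only [dotProduct, one_mul] at h5
    rw [hy]
    simp only [Pi.sub_apply, Finset.sum_sub_distrib, hr, h5, sub_zero]
  have hy0 : y = 0 := by
    funext j
    have h6 : ∑ k, y k = Fintype.card N * y j := by
      rw [Finset.sum_congr rfl fun k _ => hcon k j, Finset.sum_const, nsmul_eq_mul]
      rfl
    rw [hsum] at h6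
    have : (Fintype.card N : ℝ) ≠ 0 := by
      have : Nonempty N := ⟨j⟩
      exact_mod_cast Fintype.card_ne_zero
    rcases mul_eq_zero.1 h6.symm with h7 | h7
    exacts [absurd h7 this, h7]
  rw [hy, sub_eq_zero] at hy0
  exact hy0.symm

/-- Applying `C` to the line flows `shift *ᵥ r` recovers a balanced injection `r`. -/
theorem eq_zero_of_shift_mulVec_eq_zero {r : N → ℝ} (hr : ∑ j, r j = 0)
    (h : G.shift *ᵥ r = 0) : r = 0 := by
  rw [← G.laplacian_mulVec_pinv_mulVec hr, laplacian_mulVec]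
  have : G.shift *ᵥ r = Matrix.diagonal G.B *ᵥ
      (G.Cᵀ *ᵥ (pinv G.laplacian G.laplacian_isHermitian *ᵥ r)) := by
    simp only [shift, Matrix.mulVec_mulVec, Matrix.mul_assoc]
  rw [← this, h, Matrix.mulVec_zero]

/-! ### Boundedness and existence of primal optimizers -/

theorem ht_mulVec_inl (r : N → ℝ) (e : G.Line) : (G.Ht *ᵥ r) (Sum.inl e) = (G.shift *ᵥ r) e := by
  rw [Ht, Matrix.fromRows_mulVec, Sum.elim_inl]

theorem ht_mulVec_inr (r : N → ℝ) (e : G.Line) :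
    (G.Ht *ᵥ r) (Sum.inr e) = -(G.shift *ᵥ r) e := by
  rw [Ht, Matrix.fromRows_mulVec, Sum.elim_inr, Matrix.neg_mulVec, Pi.neg_apply]

/-- In the kernel, `q` is balanced with zero flows, so `q = 0`. The `α`-rows then give `p = 0`, and
the `ν`-rows give `ω = 0` because `θ = 0` and `D > 0`. -/
theorem residualLin_prod_injective :
    Function.Injective (G.residualLin.prod (LinearMap.funLeft ℝ ℝ G.ixθ)) := by
  rw [← LinearMap.ker_eq_bot, LinearMap.ker_eq_bot']
  intro w hw
  have hlin : G.residualLin w = 0 := congrArg Prod.fst hw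
  have hθ : ∀ e, w (G.ixθ e) = 0 := fun e => congrFun (congrArg Prod.snd hw) e
  have hα : ∀ j, w (G.ixq j) - w (G.ixp j) = 0 := fun j => congrFun hlin (G.ixα j)
  have hl : -∑ j, w (G.ixq j) = 0 := congrFun hlin G.ixlam
  have hη : ∀ e, (G.Ht *ᵥ fun j => w (G.ixq j)) e = 0 := fun e => congrFun hlin (G.ixη e)
  have hq : (fun j => w (G.ixq j)) = 0 := by
    refine G.eq_zero_of_shift_mulVec_eq_zero (neg_eq_zero.1 hl) ?_
    funext e
    rw [← ht_mulVec_inl, hη]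
    rfl
  have hν : ∀ j, ((fun j => w (G.ixq j)) - Matrix.diagonal G.D *ᵥ (fun j => w (G.ixω j))
        - G.C *ᵥ (Matrix.diagonal G.B *ᵥ fun e => w (G.ixθ e))) j = 0 :=
    fun j => congrFun hlin (G.ixν j)
  have hθ' : (fun e => w (G.ixθ e)) = 0 := funext hθ
  funext i
  rcases i with j | j | j | e
  · have h1 : w (G.ixq j) = 0 := congrFun hq j
    have h2 := hα j
    rw [h1, zero_sub, neg_eq_zero] at h2
    exact h2
  · exact congrFun hq j
  · have := hν j
    rw [hq, hθ'] at this
    simp only [Matrix.mulVec_zero, Pi.sub_apply, Pi.neg_apply, Pi.zero_apply,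
      Matrix.mulVec_diagonal, zero_sub, sub_zero, neg_eq_zero, mul_eq_zero] at this
    exact this.resolve_left (G.D_pos j).ne'
  · exact hθ e

/-- Bounds on the constraint functions and on `θ` bound all primal variables. -/
theorem exists_norm_le_of_residual (M : ℝ) : ∃ K, ∀ w : G.PrimalIdx → ℝ,
    (∀ k, ¬ G.IsEta k → |G.residual w k| ≤ M) → (∀ k, G.IsEta k → G.residual w k ≤ M) →
    (∀ e, |w (G.ixθ e)| ≤ M) → ‖w‖ ≤ K := by
  obtain ⟨K, -, hK⟩ := LinearMap.exists_antilipschitzWith _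
    (LinearMap.ker_eq_bot.2 G.residualLin_prod_injective)
  refine ⟨K * (|M| + ‖G.residual 0‖), fun w h1 h2 h3 => ?_⟩
  have hM := le_abs_self M
  have h0 := norm_nonneg (G.residual 0)
  have hsplit : ∀ k, G.residualLin w k = G.residual w k - G.residual 0 k := fun k => by
    simp [residual]
  have hr0 : ∀ k, |G.residual 0 k| ≤ ‖G.residual 0‖ := fun k => norm_le_pi_norm (G.residual 0) k
  have hη : ∀ k, G.IsEta k → G.residualLin w k ≤ |M| + ‖G.residual 0‖ := fun k hk => by
    rw [hsplit]
    have := h2 k hk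
    have := neg_le_of_abs_le (hr0 k)
    linarith
  -- The two blocks of `Ht` are opposite, so one-sided bounds on the `η`-residuals yield two-sided
  -- ones.
  have hlinr : ∀ e, G.residualLin w (G.ixη (Sum.inr e)) = -G.residualLin w (G.ixη (Sum.inl e)) := by
    intro e
    have e1 : G.residualLin w (G.ixη (Sum.inr e)) =
      (G.Ht *ᵥ fun j => w (G.ixq j)) (Sum.inr e) := rfl
    have e2 : G.residualLin w (G.ixη (Sum.inl e)) =
      (G.Ht *ᵥ fun j => w (G.ixq j)) (Sum.inl e) := rfl
    rw [e1, e2, ht_mulVec_inl, ht_mulVec_inr]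
  have hall : ∀ k, |G.residualLin w k| ≤ |M| + ‖G.residual 0‖ := by
    intro k
    by_cases hk : G.IsEta k
    · refine abs_le.2 ⟨?_, hη k hk⟩
      obtain ⟨e | e, rfl⟩ := hk
      · have := hη _ (G.isEta_ixη (Sum.inr e))
        rw [hlinr] at this
        linarith
      · have := hη _ (G.isEta_ixη (Sum.inl e))
        rw [hlinr]
        linarith
    · rw [hsplit]
      have := abs_sub (G.residual w k) (G.residual 0 k)
      have := h1 k hk
      have := hr0 k
      linarith
  have h4 := hK.le_mul_dist w 0
  rw [map_zero, dist_zero_right, dist_zero_right] at h4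
  refine h4.trans (mul_le_mul_of_nonneg_left ?_ K.2)
  have hnn : 0 ≤ |M| + ‖G.residual 0‖ := by positivity
  refine max_le ((pi_norm_le_iff_of_nonneg hnn).2 hall) ((pi_norm_le_iff_of_nonneg hnn).2 ?_)
  intro e
  have : |w (G.ixθ e)| ≤ |M| + ‖G.residual 0‖ := by linarith [h3 e]
  exact this

/-- Balanced injections are bounded by their flows. -/
theorem exists_norm_le_of_shift : ∃ K : ℝ, 0 ≤ K ∧ ∀ r : N → ℝ, ∑ j, r j = 0 →
    ‖r‖ ≤ K * ‖G.shift *ᵥ r‖ := by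
  set T : (N → ℝ) →ₗ[ℝ] ℝ × (G.Line → ℝ) :=
    (∑ j, LinearMap.proj (R := ℝ) (φ := fun _ => ℝ) j).prod (Matrix.mulVecLin G.shift) with hT
  have hTr : ∀ r, T r = (∑ j, r j, G.shift *ᵥ r) := fun r => by
    simp [hT]
  have hker : LinearMap.ker T = ⊥ := by
    rw [LinearMap.ker_eq_bot']
    intro r hr
    rw [hTr, Prod.mk_eq_zero] at hr
    exact G.eq_zero_of_shift_mulVec_eq_zero hr.1 hr.2
  obtain ⟨K, -, hK⟩ := LinearMap.exists_antilipschitzWith T hker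
  refine ⟨K, K.2, fun r hr => ?_⟩
  have h4 := hK.le_mul_dist r 0
  rw [map_zero, dist_zero_right, dist_zero_right, hTr, hr] at h4
  simpa [Prod.norm_def] using h4

/-- A feasible planner's problem has a primal optimizer. -/
theorem exists_primal_optimum (hfeas : ∃ p q ω θ, G.IsFeasible p q ω θ) :
    ∃ w, G.Satisfies Finset.univ w ∧ ∀ w', G.Satisfies Finset.univ w' → G.cost w ≤ G.cost w' := by
  set Q : Set (N → ℝ) := {q | ∑ j, (q j - G.d j) = 0 ∧ ∀ e, (G.Ht *ᵥ (q - G.d)) e ≤ G.F e} with hQ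
  have hQne : Q.Nonempty := by
    obtain ⟨p, q, ω, θ, h⟩ := hfeas
    exact ⟨q, h.2.1, h.2.2.1⟩
  have hQcl : IsClosed Q := by
    have hQ' : Q = {q | ∑ j, (q j - G.d j) = 0} ∩
        ⋂ e, {q | (G.Ht *ᵥ (q - G.d)) e ≤ G.F e} := by
      ext q
      simp [hQ]
    rw [hQ']
    refine IsClosed.inter (isClosed_eq (by fun_prop) continuous_const) ?_
    refine isClosed_iInter fun e => isClosed_le ?_ continuous_const
    exact (continuous_apply e).comp (continuous_const.matrix_mulVec (continuous_id.sub
      continuous_const))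
  have hQb : Bornology.IsBounded Q := by
    obtain ⟨K, hK0, hK⟩ := G.exists_norm_le_of_shift
    refine (isBounded_iff_forall_norm_le).2 ⟨K * ‖G.F‖ + ‖G.d‖, fun q hq => ?_⟩
    have h1 : ‖G.shift *ᵥ (q - G.d)‖ ≤ ‖G.F‖ := by
      refine (pi_norm_le_iff_of_nonneg (norm_nonneg _)).2 fun e => ?_
      have h2 := hq.2 (Sum.inl e)
      have h3 := hq.2 (Sum.inr e)
      rw [ht_mulVec_inl] at h2
      rw [ht_mulVec_inr] at h3
      have h4 := (le_abs_self _).trans (norm_le_pi_norm G.F (Sum.inl e))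
      have h5 := (le_abs_self _).trans (norm_le_pi_norm G.F (Sum.inr e))
      exact abs_le.2 ⟨by linarith, by linarith⟩
    have h2 := hK (q - G.d) hq.1
    have h3 : ‖q‖ ≤ ‖q - G.d‖ + ‖G.d‖ := by
      simpa using norm_add_le (q - G.d) G.d
    have h4 := mul_le_mul_of_nonneg_left h1 hK0
    linarith
  have hJ : Continuous fun q : N → ℝ => ∑ j, G.J j (q j) :=
    continuous_finsetSum _ fun j _ => (G.J_differentiable j).continuous.comp (continuous_apply j)
  obtain ⟨q, hq, hmin⟩ := (Metric.isCompact_of_isClosed_isBounded hQcl hQb).exists_isMinOn hQne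
    hJ.continuousOn
  -- These angles carry the whole imbalance `q - d`, so `ω = 0` is feasible. The problem thus
  -- reduces to minimizing generation cost over the compact set `Q`.
  set θ : G.Line → ℝ :=
    G.Cᵀ *ᵥ (pinv G.laplacian G.laplacian_isHermitian *ᵥ (q - G.d)) with hθ
  have hflow : G.C *ᵥ (Matrix.diagonal G.B *ᵥ θ) = q - G.d := by
    rw [hθ, ← laplacian_mulVec]
    exact G.laplacian_mulVec_pinv_mulVec hq.1
  refine ⟨Sum.elim q (Sum.elim q (Sum.elim 0 θ)), ?_, fun w' hw' => ?_⟩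
  · rw [satisfies_univ_iff]
    refine ⟨rfl, hq.1, hq.2, ?_⟩
    show q - G.d - Matrix.diagonal G.D *ᵥ 0 - G.C *ᵥ (Matrix.diagonal G.B *ᵥ θ) = 0
    rw [hflow, Matrix.mulVec_zero, sub_zero, sub_self]
  · rw [satisfies_univ_iff] at hw'
    obtain ⟨h1, h2, h3, -⟩ := hw'
    have h4 : ∑ j, G.J j (q j) ≤ ∑ j, G.J j (w' (G.ixq j)) := hmin ⟨h2, h3⟩
    have h5 : ∑ j, G.J j (w' (G.ixq j)) = ∑ j, G.J j (w' (G.ixp j)) :=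
      Finset.sum_congr rfl fun j _ => by rw [congrFun h1 j]
    have h6 : G.cost (Sum.elim q (Sum.elim q (Sum.elim 0 θ))) = ∑ j, G.J j (q j) := by
      simp [cost, plannerCost]
    have h7 : 0 ≤ ∑ j, G.D j * w' (G.ixω j) ^ 2 :=
      Finset.sum_nonneg fun j _ => mul_nonneg (G.D_pos j).le (sq_nonneg _)
    rw [h6]
    simp only [cost, plannerCost]
    linarith

/-! ### Lagrange multipliers -/

/-- Karush-Kuhn-Tucker: a minimizer of a differentiable convex function subject to the constraints
in `S` has Lagrange multipliers, without any constraint qualification. -/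
theorem exists_multipliers (S : Finset G.DualIdx) {φ : (G.PrimalIdx → ℝ) → ℝ}
    (hφ : ConvexOn ℝ univ φ) {w : G.PrimalIdx → ℝ} (hd : DifferentiableAt ℝ φ w)
    (hw : G.Satisfies S w) (hmin : ∀ w', G.Satisfies S w' → φ w ≤ φ w') :
    ∃ u : G.DualIdx → ℝ, (∀ k, G.IsEta k → 0 ≤ u k) ∧
      ∀ w', φ w ≤ φ w' + ∑ k ∈ S, u k * G.residual w' k := by
  classical
  set φ' := fderiv ℝ φ w with hφ'
  have hfd : HasFDerivAt φ φ' w := hd.hasFDerivAt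
  set A : G.DualIdx → (G.PrimalIdx → ℝ) →ₗ[ℝ] ℝ := fun k => LinearMap.proj k ∘ₗ G.residualLin with hA
  have hAk : ∀ k v, A k v = G.residualLin v k := fun k v => rfl
  have hray : ∀ (v : G.PrimalIdx → ℝ) (t : ℝ) k,
      G.residual (w + t • v) k = G.residual w k + t * A k v := by
    intro v t k
    simp only [residual, map_add, map_smul, Pi.add_apply, Pi.smul_apply, smul_eq_mul, hAk]
    ring
  -- the functionals `A k` of active constraints, with both signs for equality constraints
  set a : G.DualIdx × Bool → (G.PrimalIdx → ℝ) →ₗ[ℝ] ℝ := fun i =>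
    if i.2 then (if G.residual w i.1 = 0 then A i.1 else 0)
    else (if G.IsEta i.1 then 0 else -A i.1) with ha
  obtain ⟨u, hu, hsum⟩ := farkas (S ×ˢ (Finset.univ : Finset Bool)) a (-(φ' : _ →ₗ[ℝ] ℝ)) (by
    intro v hv
    have hact : ∀ k ∈ S, G.residual w k = 0 → A k v ≤ 0 := by
      intro k hk h0
      have := hv (k, true) (Finset.mem_product.2 ⟨hk, Finset.mem_univ _⟩)
      simpa [ha, h0] using this
    have heq : ∀ k ∈ S, ¬ G.IsEta k → A k v = 0 := by
      intro k hk he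
      have h1 := hact k hk ((hw k hk).2 he)
      have h2 := hv (k, false) (Finset.mem_product.2 ⟨hk, Finset.mem_univ _⟩)
      simp only [ha, if_neg he, Bool.false_eq_true, if_false, LinearMap.neg_apply] at h2
      linarith
    -- Constraints are affine: a direction admissible for the active ones stays feasible for small
    -- `t > 0`, and inactive ones remain strict by continuity. This is why no constraint
    -- qualification is needed.
    have hev : ∀ᶠ t : ℝ in 𝓝[>] 0, φ w ≤ φ (w + t • v) := by
      have h1 : ∀ k ∈ S, ∀ᶠ t : ℝ in 𝓝[>] 0, (G.IsEta k → G.residual (w + t • v) k ≤ 0) ∧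
          (¬ G.IsEta k → G.residual (w + t • v) k = 0) := by
        intro k hk
        by_cases he : G.IsEta k
        · rcases ((hw k hk).1 he).lt_or_eq with hlt | h0
          · have hc : Filter.Tendsto (fun t : ℝ => G.residual w k + t * A k v) (𝓝[>] 0)
                (𝓝 (G.residual w k + 0 * A k v)) :=
              ((continuous_const.add (continuous_id.mul continuous_const)).tendsto 0).mono_left
                nhdsWithin_le_nhds
            have := hc.eventually_lt_const (u := 0) (by simpa using hlt)
            filter_upwards [this] with t ht
            exact ⟨fun _ => by rw [hray]; exact ht.le, fun h => absurd he h⟩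
          · filter_upwards [self_mem_nhdsWithin] with t (ht : 0 < t)
            refine ⟨fun _ => ?_, fun h => absurd he h⟩
            rw [hray, h0, zero_add]
            exact mul_nonpos_of_nonneg_of_nonpos ht.le (hact k hk h0)
        · refine Filter.Eventually.of_forall fun t => ⟨fun h => absurd h he, fun _ => ?_⟩
          rw [hray, heq k hk he, (hw k hk).2 he]
          ring
      have h2 := (Finset.eventually_all S).2 h1
      filter_upwards [h2] with t ht
      exact hmin _ ht
    have hder : HasDerivAt (fun t : ℝ => φ (w + t • v)) (φ' v) 0 := by
      have h1 : HasDerivAt (fun t : ℝ => w + t • v) v 0 := by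
        simpa using ((hasDerivAt_id (0 : ℝ)).smul_const v).const_add w
      have h2 : HasFDerivAt φ φ' (w + (0 : ℝ) • v) := by simpa using hfd
      exact h2.comp_hasDerivAt (0 : ℝ) h1
    have hnn : 0 ≤ φ' v := by
      have h1 := (hasDerivAt_iff_tendsto_slope.1 hder).mono_left
        (nhdsWithin_mono (0 : ℝ) (s := Ioi 0) fun t (ht : 0 < t) => ht.ne')
      refine ge_of_tendsto h1 ?_
      filter_upwards [hev, self_mem_nhdsWithin] with t ht (ht0 : 0 < t)
      rw [slope_def_field]
      simp only [zero_smul, add_zero, sub_zero]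
      exact div_nonneg (by linarith) ht0.le
    simpa using hnn)
  -- Equality multipliers are differences of two Farkas coefficients. Inactive inequalities get
  -- zero, which is complementary slackness.
  refine ⟨fun k => (if G.residual w k = 0 then u (k, true) else 0) -
    (if G.IsEta k then 0 else u (k, false)), fun k hk => ?_, fun w' => ?_⟩
  · show 0 ≤ (if G.residual w k = 0 then u (k, true) else 0) -
      (if G.IsEta k then 0 else u (k, false))
    rw [if_pos hk, sub_zero]
    split_ifs
    exacts [hu _, le_rfl]
  · have h1 := hφ.add_hasFDerivAt_le hfd w'
    have h2 := hsum (w' - w)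
    rw [Finset.sum_product] at h2
    simp only [Fintype.sum_bool, LinearMap.neg_apply, ContinuousLinearMap.coe_coe] at h2
    rw [Finset.sum_congr rfl (g := fun k => u (k, true) * a (k, true) (w' - w) +
      u (k, false) * a (k, false) (w' - w))] 
    · linarith
    intro k hk
    have h3 : A k (w' - w) = G.residual w' k - G.residual w k := by
      rw [hAk, ← residual_sub, Pi.sub_apply]
    by_cases he : G.IsEta k <;> by_cases h0 : G.residual w k = 0
    · simp [ha, he, h0, h3]
    · simp [ha, he, h0]
    · simp [ha, he, h0, h3]
      ring
    · exact absurd ((hw k hk).2 he) h0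

/-- A feasible planner's problem has a primal-dual optimizer. -/
theorem exists_saddle (hfeas : ∃ p q ω θ, G.IsFeasible p q ω θ) :
    ∃ w u, G.Satisfies Finset.univ w ∧ (∀ k, G.IsEta k → 0 ≤ u k) ∧
      ∀ w', G.cost w ≤ G.lag w' u := by
  obtain ⟨w, hw, hmin⟩ := G.exists_primal_optimum hfeas
  obtain ⟨u, hu, h⟩ := G.exists_multipliers Finset.univ G.convexOn_cost
    (G.differentiable_cost w) hw hmin
  exact ⟨w, u, hw, hu, fun w' => by rw [lag_eq]; exact h w'⟩

end Network

namespace Design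

variable {G : Network N} (R : Design G)

/-! ### The reduced Lagrangian -/

/-- The dynamic entries of a primal point. -/
def restP (w : G.PrimalIdx → ℝ) : R.Z := fun i => w i.1

/-- The dynamic entries of a dual point. -/
def restD (u : G.DualIdx → ℝ) : R.Sg := fun k => u k.1

/-- The Lagrangian with the multipliers of the eliminated constraints set to zero. -/
def partialLag (w : G.PrimalIdx → ℝ) (σ : R.Sg) : ℝ :=
  G.cost w + ∑ k, σ k * G.residual w k.1

theorem fullP_restP (w : G.PrimalIdx → ℝ) : R.fullP (R.restP w) (fun i => w i.1) = w := by
  funext i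
  by_cases h : i ∈ R.redP <;> simp [fullP, restP, h]

theorem restP_fullP (z : R.Z) (x : R.ElimP) : R.restP (R.fullP z x) = z := by
  funext i
  simp [fullP, restP, i.2]

theorem sum_dual (f : G.DualIdx → ℝ) :
    ∑ k, f k = ∑ k : {k : G.DualIdx // k ∉ R.redD}, f k.1 + ∑ k ∈ R.redD, f k := by
  rw [← Fintype.sum_subtype_add_sum_subtype (fun k => k ∈ R.redD) f, add_comm]
  congr 1
  exact (Finset.sum_subtype R.redD (fun _ => Iff.rfl) f).symm

theorem lag_eq_partialLag (w : G.PrimalIdx → ℝ) (u : G.DualIdx → ℝ) :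
    G.lag w u = R.partialLag w (R.restD u) + ∑ k ∈ R.redD, u k * G.residual w k := by
  rw [G.lag_eq, R.sum_dual, partialLag, add_assoc]
  rfl

theorem lag_fullD (w : G.PrimalIdx → ℝ) (σ : R.Sg) (y : R.ElimD) :
    G.lag w (R.fullD σ y) =
      R.partialLag w σ + ∑ k : {k : G.DualIdx // k ∈ R.redD}, y.1 k * G.residual w k.1 := by
  have h1 : R.restD (R.fullD σ y) = σ := by
    funext k
    simp [fullD, restD, k.2]
  rw [lag_eq_partialLag, h1, Finset.sum_subtype R.redD (fun _ => Iff.rfl)]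
  congr 1
  refine Finset.sum_congr rfl fun k _ => ?_
  simp [fullD, k.2]

theorem partialLag_combo (w : G.PrimalIdx → ℝ) (σ σ' : R.Sg) {a b : ℝ} (hab : a + b = 1) :
    R.partialLag w (a • σ + b • σ') = a * R.partialLag w σ + b * R.partialLag w σ' := by
  simp only [partialLag, Pi.add_apply, Pi.smul_apply, smul_eq_mul, add_mul, mul_assoc,
    Finset.sum_add_distrib, ← Finset.mul_sum]
  linear_combination (-(G.cost w)) * hab

theorem convexOn_partialLag (σ : R.Sg) : ConvexOn ℝ univ fun w => R.partialLag w σ := by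
  refine ⟨convex_univ, fun w _ w' _ a b ha hb hab => ?_⟩
  have h1 := G.convexOn_cost.2 (mem_univ w) (mem_univ w') ha hb hab
  simp only [partialLag, G.residual_combo w w' hab, smul_eq_mul] at h1 ⊢
  have h2 : ∑ k : {k : G.DualIdx // k ∉ R.redD},
      σ k * (a * G.residual w k.1 + b * G.residual w' k.1) =
      a * ∑ k, σ k * G.residual w k.1 + b * ∑ k, σ k * G.residual w' k.1 := by
    rw [Finset.mul_sum, Finset.mul_sum, ← Finset.sum_add_distrib]
    exact Finset.sum_congr rfl fun k _ => by ring
  rw [h2]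
  linarith

theorem differentiable_partialLag (σ : R.Sg) : Differentiable ℝ fun w => R.partialLag w σ := by
  have h1 : Differentiable ℝ G.residual := by
    have : Differentiable ℝ fun w => G.residualLin w :=
      (LinearMap.toContinuousLinearMap G.residualLin).differentiable
    exact this.add_const _
  have h2 : ∀ k, Differentiable ℝ fun w => G.residual w k := fun k => differentiable_pi.1 h1 k
  exact G.differentiable_cost.add
    (Differentiable.fun_sum fun k _ => (h2 k.1).const_mul (σ k))

variable {R}

theorem coe_Lhat (hfin : R.Finiteness) (z : R.Z) (σ : R.Sg) :
    ((R.Lhat z σ : ℝ) : EReal) = R.reducedValue z σ :=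
  EReal.coe_toReal (hfin z σ).2 (hfin z σ).1

/-- When the eliminated constraints hold, no admissible eliminated multiplier can raise the
Lagrangian above `partialLag`. -/
theorem Lhat_le (hfin : R.Finiteness) {w : G.PrimalIdx → ℝ} (hw : G.Satisfies R.redD w)
    (σ : R.Sg) : R.Lhat (R.restP w) σ ≤ R.partialLag w σ := by
  rw [← EReal.coe_le_coe_iff, coe_Lhat hfin]
  refine iInf_le_of_le (fun i => w i.1) (iSup_le fun y => ?_)
  rw [fullP_restP, lag_fullD, EReal.coe_le_coe_iff]
  have : ∑ k : {k : G.DualIdx // k ∈ R.redD}, y.1 k * G.residual w k.1 ≤ 0 :=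
    Finset.sum_nonpos fun k _ => hw.mul_nonpos k.2 (y.2 k)
  linarith

/-- Only points that satisfy the eliminated constraints need testing: at any other point a suitable
multiplier of a violated constraint pushes the Lagrangian above `c`. With `Lhat_le` this identifies
`L̂` as an infimum of `partialLag`. -/
theorem le_Lhat (hfin : R.Finiteness) {z : R.Z} {σ : R.Sg} {c : ℝ}
    (h : ∀ w, R.restP w = z → G.Satisfies R.redD w → c ≤ R.partialLag w σ) : c ≤ R.Lhat z σ := by
  rw [← EReal.coe_le_coe_iff, coe_Lhat hfin]
  refine le_iInf fun x => ?_
  set w := R.fullP z x with hw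
  suffices ∃ y : R.ElimD, c ≤ G.lag w (R.fullD σ y) by
    obtain ⟨y, hy⟩ := this
    exact le_iSup_of_le y (EReal.coe_le_coe_iff.2 hy)
  by_cases hs : G.Satisfies R.redD w
  · refine ⟨⟨0, fun _ _ => le_rfl⟩, ?_⟩
    rw [lag_fullD]
    simpa using h w (R.restP_fullP z x) hs
  · have : ∃ k : {k : G.DualIdx // k ∈ R.redD}, G.residual w k.1 ≠ 0 ∧
        (G.IsEta k.1 → 0 < G.residual w k.1) := by
      unfold Network.Satisfies at hs
      push Not at hs
      obtain ⟨k, hk, h1⟩ := hs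
      by_cases he : G.IsEta k
      · have h2 : 0 < G.residual w k := by
          by_contra hc
          exact (h1 fun _ => not_lt.1 hc).1 he
        exact ⟨⟨k, hk⟩, h2.ne', fun _ => h2⟩
      · exact ⟨⟨k, hk⟩, (h1 fun h => absurd h he).2, fun h => absurd h he⟩
    obtain ⟨k, hk0, hk⟩ := this
    -- The multiplier is scaled so that its term equals `|c - partialLag|`. It may be negative only
    -- for an equality constraint.
    set t := |c - R.partialLag w σ| / G.residual w k.1 with ht
    refine ⟨⟨Pi.single k t, fun k' he => ?_⟩, ?_⟩
    · by_cases hkk : k' = k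
      · subst hkk
        rw [Pi.single_eq_same]
        exact div_nonneg (abs_nonneg _) (hk he).le
      · rw [Pi.single_eq_of_ne hkk]
    · rw [lag_fullD, Finset.sum_eq_single k (fun k' _ hne => by simp [hne])
        (fun h => absurd (Finset.mem_univ _) h)]
      simp only [Pi.single_eq_same]
      rw [ht, div_mul_cancel₀ _ hk0]
      have := le_abs_self (c - R.partialLag w σ)
      linarith

theorem exists_partialLag_lt (hfin : R.Finiteness) (z : R.Z) (σ : R.Sg) {c : ℝ}
    (hc : R.Lhat z σ < c) :
    ∃ w, R.restP w = z ∧ G.Satisfies R.redD w ∧ R.partialLag w σ < c := by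
  by_contra h
  push Not at h
  exact absurd (le_Lhat hfin h) (not_le.2 hc)

/-- Partial minimization of a convex function over a convex set. The infimum need not be attained,
so near-minimizers with slack `ε` are combined. -/
theorem convexOn_Lhat (hfin : R.Finiteness) (σ : R.Sg) :
    ConvexOn ℝ univ fun z => R.Lhat z σ := by
  refine ⟨convex_univ, fun z _ z' _ a b ha hb hab => ?_⟩
  refine le_of_forall_pos_lt_add fun ε hε => ?_
  obtain ⟨w, rfl, hw, h1⟩ := exists_partialLag_lt hfin z σ (lt_add_of_pos_right _ hε)
  obtain ⟨w', rfl, hw', h2⟩ := exists_partialLag_lt hfin z' σ (lt_add_of_pos_right _ hε)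
  have h3 := Lhat_le hfin (hw.combo hw' ha hb hab) σ
  have h4 := (R.convexOn_partialLag σ).2 (mem_univ w) (mem_univ w') ha hb hab
  have h5 : R.restP (a • w + b • w') = a • R.restP w + b • R.restP w' := rfl
  rw [h5] at h3
  simp only [smul_eq_mul] at h4 ⊢
  have h6 : a * R.partialLag w σ + b * R.partialLag w' σ <
      a * R.Lhat (R.restP w) σ + b * R.Lhat (R.restP w') σ + ε := by
    rcases ha.eq_or_lt with rfl | ha'
    · have : b = 1 := by linarith
      subst this
      linarith
    · have := mul_lt_mul_of_pos_left h1 ha'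
      have := mul_le_mul_of_nonneg_left h2.le hb
      nlinarith
  linarith

/-- An infimum of functions that are affine in `σ`. -/
theorem concaveOn_Lhat (hfin : R.Finiteness) (z : R.Z) :
    ConcaveOn ℝ univ fun σ => R.Lhat z σ := by
  refine ⟨convex_univ, fun σ _ σ' _ a b ha hb hab => le_Lhat hfin fun w hz hw => ?_⟩
  subst hz
  rw [R.partialLag_combo w σ σ' hab]
  have h1 := mul_le_mul_of_nonneg_left (Lhat_le hfin hw σ) ha
  have h2 := mul_le_mul_of_nonneg_left (Lhat_le hfin hw σ') hb
  simp only [smul_eq_mul]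
  linarith

/-! ### Saddle points of the reduced Lagrangian and of the planner's Lagrangian -/

theorem Lhat_le_cost (hfin : R.Finiteness) {w : G.PrimalIdx → ℝ}
    (hw : G.Satisfies Finset.univ w) {σ : R.Sg} (hσ : ∀ k, G.IsEta k.1 → 0 ≤ σ k) :
    R.Lhat (R.restP w) σ ≤ G.cost w := by
  have h1 := Lhat_le hfin (hw.mono (Finset.subset_univ _)) σ
  have h2 : ∑ k, σ k * G.residual w k.1 ≤ 0 :=
    Finset.sum_nonpos fun k _ => hw.mul_nonpos (Finset.mem_univ _) (hσ k)
  rw [partialLag] at h1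
  linarith

theorem le_Lhat_restD (hfin : R.Finiteness) {u : G.DualIdx → ℝ}
    (hu : ∀ k, G.IsEta k → 0 ≤ u k) {c : ℝ} (h : ∀ w, c ≤ G.lag w u) (z : R.Z) :
    c ≤ R.Lhat z (R.restD u) := by
  refine le_Lhat hfin fun w _ hw => (h w).trans ?_
  rw [R.lag_eq_partialLag]
  have : ∑ k ∈ R.redD, u k * G.residual w k ≤ 0 :=
    Finset.sum_nonpos fun k hk => hw.mul_nonpos hk (hu k)
  linarith

/-- Costs and right-hand sides of the dynamic constraints that can be attained at given dynamic
primal variables. -/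
def attainable (R : Design G) (z : R.Z) : Set (ℝ × R.Sg) :=
  {x | ∃ w, R.restP w = z ∧ G.Satisfies R.redD w ∧ G.cost w ≤ x.1 ∧
    ∀ k, (G.IsEta k.1 → G.residual w k.1 ≤ x.2 k) ∧ (¬ G.IsEta k.1 → G.residual w k.1 = x.2 k)}

theorem convex_attainable (z : R.Z) : Convex ℝ (R.attainable z) := by
  rintro x ⟨w, hz, hw, hc, hr⟩ x' ⟨w', hz', hw', hc', hr'⟩ a b ha hb hab
  refine ⟨a • w + b • w', ?_, hw.combo hw' ha hb hab, ?_, fun k => ⟨fun he => ?_, fun he => ?_⟩⟩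
  · have : R.restP (a • w + b • w') = a • R.restP w + b • R.restP w' := rfl
    rw [this, hz, hz', ← add_smul, hab, one_smul]
  · have h1 := G.convexOn_cost.2 (mem_univ w) (mem_univ w') ha hb hab
    have h2 := mul_le_mul_of_nonneg_left hc ha
    have h3 := mul_le_mul_of_nonneg_left hc' hb
    simp only [smul_eq_mul, Prod.fst_add, Prod.smul_fst] at h1 ⊢
    linarith
  · have h2 := mul_le_mul_of_nonneg_left ((hr k).1 he) ha
    have h3 := mul_le_mul_of_nonneg_left ((hr' k).1 he) hb
    rw [G.residual_combo w w' hab]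
    simp only [Prod.snd_add, Prod.smul_snd, Pi.add_apply, Pi.smul_apply, smul_eq_mul]
    linarith
  · rw [G.residual_combo w w' hab, (hr k).2 he, (hr' k).2 he]
    rfl

/-- Along a convergent sequence the witnesses have bounded residuals, and their `θ`-entries are
fixed by `z` because `θ` is dynamic. They are therefore bounded, and a subsequential limit is a
witness for the limit. -/
theorem isClosed_attainable (z : R.Z) : IsClosed (R.attainable z) := by
  refine IsSeqClosed.isClosed fun x y hx hxy => ?_
  choose w hz hw hc hr using hx
  obtain ⟨M, hM⟩ := isBounded_iff_forall_norm_le.1 (Metric.isBounded_range_of_tendsto x hxy)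
  have hM' : ∀ n k, |(x n).2 k| ≤ M := fun n k =>
    (norm_le_pi_norm (x n).2 k).trans ((norm_snd_le (x n)).trans (hM _ ⟨n, rfl⟩))
  have hM0 : 0 ≤ M := (norm_nonneg _).trans (hM _ ⟨0, rfl⟩)
  obtain ⟨K, hK⟩ := G.exists_norm_le_of_residual (M + ‖z‖)
  have hwK : ∀ n, w n ∈ Metric.closedBall (0 : G.PrimalIdx → ℝ) K := by
    intro n
    rw [mem_closedBall_zero_iff]
    have hzn := norm_nonneg z
    refine hK (w n) (fun k he => ?_) (fun k he => ?_) (fun e => ?_)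
    · by_cases hk : k ∈ R.redD
      · rw [(hw n k hk).2 he, abs_zero]
        linarith
      · rw [(hr n ⟨k, hk⟩).2 he]
        linarith [hM' n ⟨k, hk⟩]
    · by_cases hk : k ∈ R.redD
      · linarith [(hw n k hk).1 he]
      · linarith [(hr n ⟨k, hk⟩).1 he, hM' n ⟨k, hk⟩, le_abs_self ((x n).2 ⟨k, hk⟩)]
    · have h1 : w n (G.ixθ e) = z ⟨G.ixθ e, R.θ_notMem e⟩ := by rw [← hz n]; rfl
      rw [h1]
      linarith [norm_le_pi_norm z ⟨G.ixθ e, R.θ_notMem e⟩,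
        Real.norm_eq_abs (z ⟨G.ixθ e, R.θ_notMem e⟩)]
  obtain ⟨w₀, -, φ, hφ, hlim⟩ := tendsto_subseq_of_bounded Metric.isBounded_closedBall hwK
  have hxy' := hxy.comp hφ.tendsto_atTop
  have hres : ∀ k, Filter.Tendsto (fun n => G.residual (w (φ n)) k) Filter.atTop
      (𝓝 (G.residual w₀ k)) := fun k =>
    (((continuous_apply k).comp G.continuous_residual).tendsto w₀).comp hlim
  have hx2 : ∀ k, Filter.Tendsto (fun n => (x (φ n)).2 k) Filter.atTop (𝓝 (y.2 k)) := fun k =>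
    (((continuous_apply k).comp continuous_snd).tendsto y).comp hxy'
  refine ⟨w₀, ?_, fun k hk => ⟨fun he => ?_, fun he => ?_⟩, ?_,
    fun k => ⟨fun he => ?_, fun he => ?_⟩⟩
  · funext i
    have h1 : Filter.Tendsto (fun n => w (φ n) i.1) Filter.atTop (𝓝 (w₀ i.1)) :=
      ((continuous_apply i.1).tendsto w₀).comp hlim
    have h2 : (fun n => w (φ n) i.1) = fun _ => z i := by
      funext n
      rw [← hz (φ n)]
      rfl
    rw [h2] at h1
    exact tendsto_nhds_unique tendsto_const_nhds h1 |>.symm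
  · exact le_of_tendsto' (hres k) fun n => (hw (φ n) k hk).1 he
  · refine tendsto_nhds_unique (hres k) ?_
    exact tendsto_const_nhds.congr fun n => ((hw (φ n) k hk).2 he).symm
  · exact le_of_tendsto_of_tendsto' ((G.differentiable_cost.continuous.tendsto w₀).comp hlim)
      ((continuous_fst.tendsto y).comp hxy') fun n => hc (φ n)
  · exact le_of_tendsto_of_tendsto' (hres k.1) (hx2 k) fun n => (hr (φ n) k).1 he
  · exact tendsto_nhds_unique (hres k.1) ((hx2 k).congr fun n => ((hr (φ n) k).2 he).symm)

/-- If the reduced Lagrangian at `z` is bounded above by `c` in the dual variables, then `z` is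
completed to a feasible point of cost at most `c`. -/
theorem exists_satisfies_of_Lhat_le (hfin : R.Finiteness) {z : R.Z} {c : ℝ}
    (h : ∀ σ : R.Sg, (∀ k, G.IsEta k.1 → 0 ≤ σ k) → R.Lhat z σ ≤ c) :
    ∃ w, R.restP w = z ∧ G.Satisfies Finset.univ w ∧ G.cost w ≤ c := by
  by_cases hmem : ((c, 0) : ℝ × R.Sg) ∈ R.attainable z
  · obtain ⟨w, hz, hw, hc, hr⟩ := hmem
    refine ⟨w, hz, fun k _ => ?_, hc⟩
    by_cases hk : k ∈ R.redD
    · exact hw k hk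
    · exact hr ⟨k, hk⟩
  exfalso
  -- A hyperplane separates `(c, 0)` from the attainable set. Upward closedness in the cost and in
  -- the `η`-coordinates makes `s` and those entries of `β` nonnegative, so `β` scales to an
  -- admissible dual point.
  obtain ⟨f, m, hf, hfm⟩ := geometric_hahn_banach_point_closed (convex_attainable z)
    (isClosed_attainable z) hmem
  set s := f (1, 0) with hs
  set β : R.Sg := fun k => f (0, Pi.single k 1) with hβ
  have hfx : ∀ t (b : R.Sg), f (t, b) = s * t + ∑ k, β k * b k := by
    intro t b
    have h1 : ((t, b) : ℝ × R.Sg) = t • (1, 0) + ∑ k, b k • ((0, Pi.single k 1) : ℝ × R.Sg) := by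
      refine Prod.ext ?_ ?_
      · simp [Prod.fst_sum]
      · simp only [Prod.snd_add, Prod.smul_snd, smul_zero, zero_add, Prod.snd_sum]
        exact pi_eq_sum_univ' b
    rw [h1, map_add, map_smul, map_sum, smul_eq_mul, mul_comm]
    congr 1
    exact Finset.sum_congr rfl fun k _ => by rw [map_smul, smul_eq_mul, mul_comm]
  rw [hfx] at hf
  simp only [Pi.zero_apply, mul_zero, Finset.sum_const_zero, add_zero] at hf
  have hw_all : ∀ w, R.restP w = z → G.Satisfies R.redD w → ∀ t, G.cost w ≤ t →
      m < s * t + ∑ k, β k * G.residual w k.1 := by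
    intro w hz hw t ht
    have := hfm (t, R.restD (G.residual w)) ⟨w, hz, hw, ht, fun k => ⟨fun _ => le_rfl, fun _ => rfl⟩⟩
    rwa [hfx] at this
  obtain ⟨w₀, hz₀, hw₀, -⟩ := exists_partialLag_lt hfin z 0 (lt_add_one _)
  have hray : ∀ A B : ℝ, (∀ t, 0 ≤ t → m < A + t * B) → 0 ≤ B := by
    intro A B hAB
    by_contra hB
    push Not at hB
    have h1 := hAB (|m - A| / -B) (div_nonneg (abs_nonneg _) (by linarith))
    have h2 : |m - A| / -B * B = -|m - A| := by
      rw [div_neg, neg_mul, div_mul_cancel₀ _ hB.ne]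
    rw [h2] at h1
    have := neg_abs_le (m - A)
    have := le_abs_self (m - A)
    linarith
  have hs0 : 0 ≤ s := by
    refine hray (s * G.cost w₀ + ∑ k, β k * G.residual w₀ k.1) s fun t ht => ?_
    have := hw_all w₀ hz₀ hw₀ (G.cost w₀ + t) (by linarith)
    linarith
  have hβ0 : ∀ k, G.IsEta k.1 → 0 ≤ β k := by
    intro k he
    refine hray (s * G.cost w₀ + ∑ k, β k * G.residual w₀ k.1) (β k) fun t ht => ?_
    have := hfm (G.cost w₀, R.restD (G.residual w₀) + Pi.single k t)
      ⟨w₀, hz₀, hw₀, le_rfl, fun k' => ⟨fun _ => ?_, fun he' => ?_⟩⟩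
    · rw [hfx] at this
      simp only [Pi.add_apply, mul_add, Finset.sum_add_distrib] at this
      rw [Finset.sum_eq_single (f := fun x => β x * (Pi.single k t : R.Sg) x) k
        (fun k' _ hne => by simp [hne]) (fun h => absurd (Finset.mem_univ _) h)] at this
      rw [Pi.single_eq_same] at this
      have e : ∑ k, β k * R.restD (G.residual w₀) k = ∑ k, β k * G.residual w₀ k.1 := rfl
      rw [e] at this
      linarith
    · have : 0 ≤ (Pi.single k t : R.Sg) k' := by
        by_cases hkk : k' = k
        · subst hkk
          rwa [Pi.single_eq_same]
        · rw [Pi.single_eq_of_ne hkk]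
      show G.residual w₀ k'.1 ≤ G.residual w₀ k'.1 + (Pi.single k t : R.Sg) k'
      linarith
    · have hkk : k' ≠ k := fun e => he' (e ▸ he)
      show G.residual w₀ k'.1 = G.residual w₀ k'.1 + (Pi.single k t : R.Sg) k'
      rw [Pi.single_eq_of_ne hkk, add_zero]
  -- For a vertical hyperplane (`s = 0`), large multiples of `β` drive `L̂` above `c`. Otherwise `β
  -- / s` already gives at least `m / s > c`.
  rcases hs0.eq_or_lt with hs1 | hs1
  · rw [← hs1, zero_mul] at hf
    set K := (|c - R.Lhat z 0| + 1) / m with hK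
    have hK0 : 0 ≤ K := by positivity
    have h1 : R.Lhat z 0 + K * m ≤ R.Lhat z (K • β) := by
      refine le_Lhat hfin fun w hz hw => ?_
      have h2 := hw_all w hz hw _ le_rfl
      have h3 := Lhat_le hfin hw 0
      rw [hz] at h3
      rw [← hs1, zero_mul, zero_add] at h2
      have h4 := mul_le_mul_of_nonneg_left h2.le hK0
      simp only [partialLag, Pi.zero_apply, zero_mul, Finset.sum_const_zero, Pi.smul_apply,
        smul_eq_mul, mul_assoc, ← Finset.mul_sum] at h3 ⊢
      linarith
    have h2 := h (K • β) fun k he => mul_nonneg hK0 (hβ0 k he)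
    have h3 : K * m = |c - R.Lhat z 0| + 1 := div_mul_cancel₀ _ hf.ne'
    have := le_abs_self (c - R.Lhat z 0)
    linarith
  · have h1 : m / s ≤ R.Lhat z (s⁻¹ • β) := by
      refine le_Lhat hfin fun w hz hw => ?_
      have h2 := hw_all w hz hw _ le_rfl
      rw [div_le_iff₀ hs1]
      simp only [partialLag, Pi.smul_apply, smul_eq_mul, mul_assoc, ← Finset.mul_sum]
      rw [add_mul, mul_right_comm, inv_mul_cancel₀ hs1.ne', one_mul]
      linarith
    have h2 := h (s⁻¹ • β) fun k he => mul_nonneg (inv_nonneg.2 hs1.le) (hβ0 k he)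
    have h3 : c < m / s := by
      rw [lt_div_iff₀ hs1]
      linarith
    linarith

/-- If the reduced Lagrangian at `σ` is bounded below by the cost of a feasible point, then `σ` is
completed to an optimal dual point. -/
theorem exists_dual_of_le_Lhat (hfin : R.Finiteness) {σ : R.Sg}
    (hσ : ∀ k, G.IsEta k.1 → 0 ≤ σ k) {w : G.PrimalIdx → ℝ} (hw : G.Satisfies Finset.univ w)
    (h : ∀ z, G.cost w ≤ R.Lhat z σ) :
    ∃ y : R.ElimD, ∀ w', G.cost w ≤ G.lag w' (R.fullD σ y) := by
  have hle : R.partialLag w σ ≤ G.cost w := by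
    have h2 : ∑ k, σ k * G.residual w k.1 ≤ 0 :=
      Finset.sum_nonpos fun k _ => hw.mul_nonpos (Finset.mem_univ _) (hσ k)
    rw [partialLag]
    linarith
  have hge : ∀ w', G.Satisfies R.redD w' → G.cost w ≤ R.partialLag w' σ := fun w' hw' =>
    (h (R.restP w')).trans (Lhat_le hfin hw' σ)
  -- The point `w` minimizes `partialLag · σ` under the eliminated constraints, whose multipliers
  -- are the missing dual variables.
  obtain ⟨u, hu, hall⟩ := G.exists_multipliers R.redD (R.convexOn_partialLag σ)
    (R.differentiable_partialLag σ w) (hw.mono (Finset.subset_univ _))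
    (fun w' hw' => hle.trans (hge w' hw'))
  refine ⟨⟨fun k => u k.1, fun k he => hu k.1 he⟩, fun w' => ?_⟩
  rw [lag_fullD]
  have h1 := hall w'
  have h2 := hge w (hw.mono (Finset.subset_univ _))
  rw [Finset.sum_subtype R.redD (fun _ => Iff.rfl)] at h1
  linarith

/-- `s` is a saddle point of the reduced Lagrangian on `𝕀`. -/
def IsSaddle (R : Design G) (s : R.State) : Prop :=
  s ∈ R.initialSet ∧ ∀ v ∈ R.initialSet, R.Lhat s.1 v.2 ≤ R.Lhat v.1 s.2

/-- The optimal cost lies between the two sides of the saddle inequality, by weak duality on the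
left and dual optimality on the right. -/
theorem exists_isSaddle (hfeas : ∃ p q ω θ, G.IsFeasible p q ω θ) (hfin : R.Finiteness) :
    ∃ s, R.IsSaddle s := by
  obtain ⟨w, u, hw, hu, h⟩ := G.exists_saddle hfeas
  exact ⟨(R.restP w, R.restD u), fun k he => hu k.1 he, fun v hv =>
    (Lhat_le_cost hfin hw hv).trans (le_Lhat_restD hfin hu h v.1)⟩

/-- Comparison with one known optimum bounds `L̂(s.1, ·)` above and `L̂(·, s.2)` below by the
optimal cost. The primal and dual parts can then be completed independently, without a duality gap.
-/
theorem IsSaddle.correspondsToOptimum (hfeas : ∃ p q ω θ, G.IsFeasible p q ω θ)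
    (hfin : R.Finiteness) {s : R.State} (hs : R.IsSaddle s) : R.CorrespondsToOptimum s := by
  obtain ⟨w, u, hw, hu, h⟩ := G.exists_saddle hfeas
  have hu' : ∀ k : {k : G.DualIdx // k ∉ R.redD}, G.IsEta k.1 → 0 ≤ R.restD u k :=
    fun k he => hu k.1 he
  obtain ⟨w', hz, hw', hc⟩ := exists_satisfies_of_Lhat_le (R := R) hfin (z := s.1) (c := G.cost w)
    fun σ hσ => (hs.2 (R.restP w, σ) hσ).trans (Lhat_le_cost hfin hw hs.1)
  obtain ⟨y, hy⟩ := exists_dual_of_le_Lhat (R := R) hfin (σ := s.2) hs.1 hw fun z =>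
    (le_Lhat_restD hfin hu h s.1).trans (hs.2 (z, R.restD u) hu')
  refine ⟨fun i => w' i.1, y, ?_⟩
  rw [← hz, fullP_restP]
  refine G.isOptimal_of_forall_le hw' (fun k he => ?_) fun w'' => hc.trans (hy w'')
  by_cases hk : k ∈ R.redD
  · simpa [fullD, hk] using y.2 ⟨k, hk⟩ he
  · simpa [fullD, hk] using hs.1 ⟨k, hk⟩ he

end Design

theorem _root_.HasDerivAt.nonpos_of_eventually_le {f : ℝ → ℝ} {f' x : ℝ} (h : HasDerivAt f f' x)
    (hle : ∀ᶠ y in 𝓝[>] x, f y ≤ f x) : f' ≤ 0 := by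
  have h1 := (hasDerivAt_iff_tendsto_slope.1 h).mono_left
    (nhdsWithin_mono x (s := Ioi x) fun t (ht : x < t) => ht.ne')
  refine le_of_tendsto h1 ?_
  filter_upwards [hle, self_mem_nhdsWithin] with t ht (ht0 : x < t)
  rw [slope_def_field]
  exact div_nonpos_of_nonpos_of_nonneg (by linarith) (by linarith)

namespace Design

variable {G : Network N} {R : Design G}

/-! ### Gradients of the reduced Lagrangian -/

theorem _root_.Differentiable.curry_left {E F : Type*} [NormedAddCommGroup E] [NormedSpace ℝ E]
    [NormedAddCommGroup F] [NormedSpace ℝ F] {f : E → F → ℝ}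
    (hf : Differentiable ℝ fun s : E × F => f s.1 s.2) (y : F) :
    Differentiable ℝ fun x => f x y :=
  hf.comp (differentiable_id.prodMk (differentiable_const y))

theorem _root_.Differentiable.curry_right {E F : Type*} [NormedAddCommGroup E] [NormedSpace ℝ E]
    [NormedAddCommGroup F] [NormedSpace ℝ F] {f : E → F → ℝ}
    (hf : Differentiable ℝ fun s : E × F => f s.1 s.2) (x : E) :
    Differentiable ℝ fun y => f x y :=
  hf.comp ((differentiable_const x).prodMk differentiable_id)

theorem differentiable_Lhat_left (hdiff : R.LhatDifferentiable) (σ : R.Sg) :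
    Differentiable ℝ fun z => R.Lhat z σ :=
  Differentiable.curry_left (f := R.Lhat) hdiff σ

theorem differentiable_Lhat_right (hdiff : R.LhatDifferentiable) (z : R.Z) :
    Differentiable ℝ fun σ => R.Lhat z σ :=
  Differentiable.curry_right (f := R.Lhat) hdiff z

theorem hasDerivAt_Lhat_update_left (hdiff : R.LhatDifferentiable) (s : R.State)
    (i : {i : G.PrimalIdx // i ∉ R.redP}) :
    HasDerivAt (fun r => R.Lhat (Function.update s.1 i r) s.2) (R.gradZ s i) (s.1 i) :=
  ((differentiable_Lhat_left hdiff s.2 _).comp _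
    (hasDerivAt_update s.1 i (s.1 i)).differentiableAt).hasDerivAt

theorem hasDerivAt_Lhat_update_right (hdiff : R.LhatDifferentiable) (s : R.State)
    (k : {k : G.DualIdx // k ∉ R.redD}) :
    HasDerivAt (fun r => R.Lhat s.1 (Function.update s.2 k r)) (R.gradσ s k) (s.2 k) :=
  ((differentiable_Lhat_right hdiff s.1 _).comp _
    (hasDerivAt_update s.2 k (s.2 k)).differentiableAt).hasDerivAt

theorem _root_.fderiv_pi_apply_eq_sum {ι : Type*} [Fintype ι] [DecidableEq ι] {f : (ι → ℝ) → ℝ}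
    {x : ι → ℝ} (hf : DifferentiableAt ℝ f x) (v : ι → ℝ) :
    fderiv ℝ f x v = ∑ i, deriv (fun r => f (Function.update x i r)) (x i) * v i := by
  conv_lhs => rw [pi_eq_sum_univ' v]
  rw [map_sum]
  refine Finset.sum_congr rfl fun i _ => ?_
  rw [map_smul, smul_eq_mul, mul_comm]
  congr 1
  have h1 : HasFDerivAt f (fderiv ℝ f x) (Function.update x i (x i)) := by
    rw [Function.update_eq_self]
    exact hf.hasFDerivAt
  exact (h1.comp_hasDerivAt (x i) (hasDerivAt_update x i (x i))).deriv.symm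

theorem sum_gradZ_le (hfin : R.Finiteness) (hdiff : R.LhatDifferentiable) (s : R.State)
    (z : R.Z) : ∑ i, R.gradZ s i * (z i - s.1 i) ≤ R.Lhat z s.2 - R.Lhat s.1 s.2 := by
  have h1 := (convexOn_Lhat hfin s.2).add_hasFDerivAt_le
    (differentiable_Lhat_left hdiff s.2 s.1).hasFDerivAt z
  rw [fderiv_pi_apply_eq_sum (differentiable_Lhat_left hdiff s.2 s.1)] at h1
  simp only [Pi.sub_apply] at h1
  simp only [gradZ]
  linarith

theorem le_sum_gradσ (hfin : R.Finiteness) (hdiff : R.LhatDifferentiable) (s : R.State)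
    (σ : R.Sg) : R.Lhat s.1 σ - R.Lhat s.1 s.2 ≤ ∑ k, R.gradσ s k * (σ k - s.2 k) := by
  have h1 := (concaveOn_Lhat hfin s.1).le_add_hasFDerivAt
    (differentiable_Lhat_right hdiff s.1 s.2).hasFDerivAt σ
  rw [fderiv_pi_apply_eq_sum (differentiable_Lhat_right hdiff s.1 s.2)] at h1
  simp only [Pi.sub_apply] at h1
  simp only [gradσ]
  linarith

/-! ### The inner product weighted by the time constants -/

variable (R) in
/-- The inner product weighted by the time constants. -/
def wip (a b : R.State) : ℝ :=
  ∑ i, R.τP i.1 * (a.1 i * b.1 i) + ∑ k, R.τD k.1 * (a.2 k * b.2 k)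

variable (R) in
/-- The squared norm weighted by the time constants. -/
def energy (a : R.State) : ℝ := R.wip a a

theorem wip_sub_left (a b c : R.State) : R.wip (a - b) c = R.wip a c - R.wip b c := by
  simp only [wip, Prod.fst_sub, Prod.snd_sub, Pi.sub_apply, sub_mul, mul_sub,
    Finset.sum_sub_distrib]
  ring

theorem wip_sub_comm (a b c : R.State) : R.wip a (b - c) = -R.wip a (c - b) := by
  simp only [wip, Prod.fst_sub, Prod.snd_sub, Pi.sub_apply, mul_sub, Finset.sum_sub_distrib]
  ring

theorem wip_zero_left (a : R.State) : R.wip 0 a = 0 := by simp [wip]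

theorem energy_nonneg (a : R.State) : 0 ≤ R.energy a :=
  add_nonneg
    (Finset.sum_nonneg fun i _ => mul_nonneg (R.τP_pos i.1).le (mul_self_nonneg _))
    (Finset.sum_nonneg fun k _ => mul_nonneg (R.τD_pos k.1).le (mul_self_nonneg _))

theorem energy_zero : R.energy 0 = 0 := wip_zero_left 0

theorem continuous_energy : Continuous R.energy := by
  unfold energy wip
  fun_prop

variable (R) in
theorem exists_energy_bounds : ∃ K : ℝ, 0 < K ∧
    ∀ a : R.State, R.energy a ≤ K * ‖a‖ ^ 2 ∧ ‖a‖ ^ 2 ≤ K * R.energy a := by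
  set A := ∑ i : {i : G.PrimalIdx // i ∉ R.redP}, R.τP i.1 +
    ∑ k : {k : G.DualIdx // k ∉ R.redD}, R.τD k.1 with hA
  set B := ∑ i : {i : G.PrimalIdx // i ∉ R.redP}, (R.τP i.1)⁻¹ +
    ∑ k : {k : G.DualIdx // k ∉ R.redD}, (R.τD k.1)⁻¹ with hB
  have hP : ∀ i, 0 < R.τP i := R.τP_pos
  have hD : ∀ k, 0 < R.τD k := R.τD_pos
  have hA0 : 0 ≤ A := add_nonneg (Finset.sum_nonneg fun i _ => (hP i.1).le)
    (Finset.sum_nonneg fun k _ => (hD k.1).le)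
  have hBP : 0 ≤ ∑ i : {i : G.PrimalIdx // i ∉ R.redP}, (R.τP i.1)⁻¹ :=
    Finset.sum_nonneg fun i _ => (inv_pos.2 (hP i.1)).le
  have hBD : 0 ≤ ∑ k : {k : G.DualIdx // k ∉ R.redD}, (R.τD k.1)⁻¹ :=
    Finset.sum_nonneg fun k _ => (inv_pos.2 (hD k.1)).le
  refine ⟨A + B + 1, by positivity, fun a => ⟨?_, ?_⟩⟩
  · have h1 : ∀ x : ℝ, |x| ≤ ‖a‖ → x * x ≤ ‖a‖ ^ 2 := fun x hx => by
      rw [← sq]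
      exact sq_le_sq' (neg_le_of_abs_le hx) (le_of_abs_le hx)
    have h2 : ∑ i, R.τP i.1 * (a.1 i * a.1 i) ≤
        (∑ i : {i : G.PrimalIdx // i ∉ R.redP}, R.τP i.1) * ‖a‖ ^ 2 := by
      rw [Finset.sum_mul]
      exact Finset.sum_le_sum fun i _ => mul_le_mul_of_nonneg_left
        (h1 _ ((norm_le_pi_norm a.1 i).trans (norm_fst_le a))) (hP i.1).le
    have h3 : ∑ k, R.τD k.1 * (a.2 k * a.2 k) ≤
        (∑ k : {k : G.DualIdx // k ∉ R.redD}, R.τD k.1) * ‖a‖ ^ 2 := by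
      rw [Finset.sum_mul]
      exact Finset.sum_le_sum fun k _ => mul_le_mul_of_nonneg_left
        (h1 _ ((norm_le_pi_norm a.2 k).trans (norm_snd_le a))) (hD k.1).le
    have h4 : R.energy a ≤ A * ‖a‖ ^ 2 := by
      rw [hA, add_mul]
      exact add_le_add h2 h3
    have h5 : 0 ≤ (B + 1) * ‖a‖ ^ 2 := by positivity
    linarith
  · have hE := energy_nonneg a
    have hEP : 0 ≤ ∑ i, R.τP i.1 * (a.1 i * a.1 i) :=
      Finset.sum_nonneg fun i _ => mul_nonneg (hP i.1).le (mul_self_nonneg _)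
    have hED : 0 ≤ ∑ k, R.τD k.1 * (a.2 k * a.2 k) :=
      Finset.sum_nonneg fun k _ => mul_nonneg (hD k.1).le (mul_self_nonneg _)
    have key : ∀ x τ : ℝ, 0 < τ → τ * (x * x) ≤ R.energy a → τ⁻¹ ≤ B →
        |x| ≤ Real.sqrt ((A + B + 1) * R.energy a) := by
      intro x τ hτ h1 h2
      refine Real.abs_le_sqrt ?_
      calc x ^ 2 = τ⁻¹ * (τ * (x * x)) := by field_simp
        _ ≤ B * R.energy a := mul_le_mul h2 h1 (mul_nonneg hτ.le (mul_self_nonneg _)) (by positivity)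
        _ ≤ (A + B + 1) * R.energy a := mul_le_mul_of_nonneg_right (by linarith) hE
    have h1 : ‖a‖ ≤ Real.sqrt ((A + B + 1) * R.energy a) := by
      refine max_le ((pi_norm_le_iff_of_nonneg (Real.sqrt_nonneg _)).2 fun i => ?_)
        ((pi_norm_le_iff_of_nonneg (Real.sqrt_nonneg _)).2 fun k => ?_)
      · refine key _ (R.τP i.1) (hP i.1) ?_ ?_
        · have := Finset.single_le_sum (f := fun i => R.τP i.1 * (a.1 i * a.1 i))
            (fun i _ => mul_nonneg (hP i.1).le (mul_self_nonneg _)) (Finset.mem_univ i)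
          exact this.trans (le_add_of_nonneg_right hED)
        · have := Finset.single_le_sum
            (f := fun i : {i : G.PrimalIdx // i ∉ R.redP} => (R.τP i.1)⁻¹)
            (fun i _ => (inv_pos.2 (hP i.1)).le) (Finset.mem_univ i)
          exact this.trans (le_add_of_nonneg_right hBD)
      · refine key _ (R.τD k.1) (hD k.1) ?_ ?_
        · have := Finset.single_le_sum (f := fun k => R.τD k.1 * (a.2 k * a.2 k))
            (fun k _ => mul_nonneg (hD k.1).le (mul_self_nonneg _)) (Finset.mem_univ k)
          exact this.trans (le_add_of_nonneg_left hEP)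
        · have := Finset.single_le_sum
            (f := fun k : {k : G.DualIdx // k ∉ R.redD} => (R.τD k.1)⁻¹)
            (fun k _ => (inv_pos.2 (hD k.1)).le) (Finset.mem_univ k)
          exact this.trans (le_add_of_nonneg_left hBP)
    have h2 : 0 ≤ (A + B + 1) * R.energy a := by positivity
    calc ‖a‖ ^ 2 ≤ Real.sqrt ((A + B + 1) * R.energy a) ^ 2 :=
          pow_le_pow_left₀ (norm_nonneg _) h1 2
      _ = _ := Real.sq_sqrt h2

/-! ### The variational inequality of the loop -/

/-- The time constants cancel, and the gradient inequalities in `z` and `σ` add up; the terms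
`L̂(s.1, s.2)` drop out. -/
theorem wip_field_le (hfin : R.Finiteness) (hdiff : R.LhatDifferentiable) {s v : R.State}
    (hs : s ∈ R.initialSet) (hv : v ∈ R.initialSet) :
    R.wip (R.field s) (s - v) ≤ R.Lhat v.1 s.2 - R.Lhat s.1 v.2 := by
  have h1 := sum_gradZ_le hfin hdiff s v.1
  have h2 := le_sum_gradσ hfin hdiff s v.2
  have h3 : ∑ i, R.τP i.1 * ((R.field s).1 i * (s - v).1 i) =
      ∑ i, R.gradZ s i * (v.1 i - s.1 i) := by
    refine Finset.sum_congr rfl fun i _ => ?_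
    have := (R.τP_pos i.1).ne'
    simp only [field, Prod.fst_sub, Pi.sub_apply]
    field_simp
    ring
  have h4 : ∑ k, R.τD k.1 * ((R.field s).2 k * (s - v).2 k) ≤
      -∑ k, R.gradσ s k * (v.2 k - s.2 k) := by
    rw [← Finset.sum_neg_distrib]
    refine Finset.sum_le_sum fun k _ => ?_
    have hτ := (R.τD_pos k.1).ne'
    simp only [field, Prod.snd_sub, Pi.sub_apply]
    rw [← mul_assoc, ← mul_assoc, mul_inv_cancel₀ hτ, one_mul]
    split_ifs with he
    · unfold proj
      split_ifs with hp
      · linarith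
      -- The projection is active only where the gradient is nonpositive and `η = 0`. Discarding the
      -- gradient there costs nothing, since `v` has a nonnegative entry.
      · push Not at hp
        have hs0 : s.2 k = 0 := le_antisymm hp.2 (hs k he)
        have := mul_nonpos_of_nonpos_of_nonneg hp.1 (hv k he)
        rw [hs0]
        linarith
    · linarith
  unfold wip
  linarith

/-- Converse of `wip_field_le`, by varying one coordinate of `v` and using Fermat's rule. At `η = 0`
only a one-sided variation is allowed and yields a nonpositive gradient, so `hd` must supply the
zero velocity. -/
theorem eq_field_of_wip_le (hdiff : R.LhatDifferentiable) {s d : R.State}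
    (hs : s ∈ R.initialSet)
    (h : ∀ v ∈ R.initialSet, R.wip d (s - v) ≤ R.Lhat v.1 s.2 - R.Lhat s.1 v.2)
    (hd : ∀ k, G.IsEta k.1 → s.2 k = 0 → d.2 k = 0) : d = R.field s := by
  refine Prod.ext (funext fun i => ?_) (funext fun k => ?_)
  · have hτ := R.τP_pos i.1
    have hmin : ∀ r, R.Lhat (Function.update s.1 i (s.1 i)) s.2 + R.τP i.1 * d.1 i * s.1 i ≤
        R.Lhat (Function.update s.1 i r) s.2 + R.τP i.1 * d.1 i * r := by
      intro r
      have h1 := h (Function.update s.1 i r, s.2) hs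
      have h2 : R.wip d (s - (Function.update s.1 i r, s.2)) =
          R.τP i.1 * (d.1 i * (s.1 i - r)) := by
        unfold wip
        rw [Finset.sum_eq_single i (fun j _ hne => by simp [Function.update_of_ne hne])
          (fun h => absurd (Finset.mem_univ _) h)]
        simp
      rw [h2] at h1
      rw [Function.update_eq_self]
      simp only at h1
      linarith
    have hder := (hasDerivAt_Lhat_update_left hdiff s i).add
      ((hasDerivAt_id (s.1 i)).const_mul (R.τP i.1 * d.1 i))
    have h0 := IsLocalMin.hasDerivAt_eq_zero (Filter.Eventually.of_forall hmin) hder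
    simp only [field]
    field_simp
    linarith
  · have hτ := R.τD_pos k.1
    have hmax : ∀ r, (G.IsEta k.1 → 0 ≤ r) → R.Lhat s.1 (Function.update s.2 k r) -
        R.τD k.1 * d.2 k * r ≤
        R.Lhat s.1 (Function.update s.2 k (s.2 k)) - R.τD k.1 * d.2 k * s.2 k := by
      intro r hr
      have h1 := h (s.1, Function.update s.2 k r) (fun k' he => by
        by_cases hkk : k' = k
        · subst hkk
          simpa using hr he
        · simpa [Function.update_of_ne hkk] using hs k' he)
      have h2 : R.wip d (s - (s.1, Function.update s.2 k r)) =
          R.τD k.1 * (d.2 k * (s.2 k - r)) := by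
        unfold wip
        rw [Finset.sum_eq_single (f := fun k' => R.τD k'.1 *
            (d.2 k' * (s - (s.1, Function.update s.2 k r)).2 k')) k
          (fun j _ hne => by simp [Function.update_of_ne hne])
          (fun h => absurd (Finset.mem_univ _) h)]
        simp
      rw [h2] at h1
      rw [Function.update_eq_self]
      simp only at h1
      linarith
    have hder := (hasDerivAt_Lhat_update_right hdiff s k).sub
      ((hasDerivAt_id (s.2 k)).const_mul (R.τD k.1 * d.2 k))
    have hfree : (∀ᶠ r in 𝓝 (s.2 k), G.IsEta k.1 → 0 ≤ r) → R.gradσ s k = R.τD k.1 * d.2 k := by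
      intro hev
      have hloc : IsLocalMax ((fun r => R.Lhat s.1 (Function.update s.2 k r)) -
          fun r => R.τD k.1 * d.2 k * id r) (s.2 k) := by
        filter_upwards [hev] with r hr
        exact hmax r hr
      have h0 := IsLocalMax.hasDerivAt_eq_zero hloc hder
      linarith
    simp only [field]
    split_ifs with he
    · unfold proj
      rcases (hs k he).lt_or_eq with hlt | h0
      · rw [if_pos (Or.inr hlt), hfree]
        · field_simp
        · filter_upwards [lt_mem_nhds hlt] with r hr _ using hr.le
      · have hg : R.gradσ s k ≤ 0 := by
          refine (hasDerivAt_Lhat_update_right hdiff s k).nonpos_of_eventually_le ?_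
          filter_upwards [self_mem_nhdsWithin] with r (hr : s.2 k < r)
          have := hmax r fun _ => (hs k he).trans hr.le
          rw [hd k he h0.symm] at this
          simpa using this
        rw [if_neg, mul_zero, hd k he h0.symm]
        rintro (h1 | h1)
        · linarith
        · rw [← h0] at h1
          exact lt_irrefl _ h1
    · rw [hfree (Filter.Eventually.of_forall fun _ h => absurd h he)]
      field_simp

theorem mem_equilibria_iff_isSaddle (hfin : R.Finiteness) (hdiff : R.LhatDifferentiable)
    (s : R.State) : s ∈ R.equilibria ↔ R.IsSaddle s := by
  constructor
  · rintro ⟨hs, h0⟩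
    refine ⟨hs, fun v hv => ?_⟩
    have := wip_field_le hfin hdiff hs hv
    rw [h0, wip_zero_left] at this
    linarith
  · rintro ⟨hs, h⟩
    refine ⟨hs, (eq_field_of_wip_le hdiff hs (fun v hv => ?_) fun _ _ _ => rfl).symm⟩
    rw [wip_zero_left]
    linarith [h v hv]

/-! ### Calculus along trajectories -/

theorem hasDerivAt_fst_apply {s : ℝ → R.State} {d : R.State} {t : ℝ} (h : HasDerivAt s d t)
    (i : {i : G.PrimalIdx // i ∉ R.redP}) : HasDerivAt (fun t => (s t).1 i) (d.1 i) t :=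
  hasDerivAt_pi.1 (hasFDerivAt_fst.comp_hasDerivAt t h) i

theorem hasDerivAt_snd_apply {s : ℝ → R.State} {d : R.State} {t : ℝ} (h : HasDerivAt s d t)
    (k : {k : G.DualIdx // k ∉ R.redD}) : HasDerivAt (fun t => (s t).2 k) (d.2 k) t :=
  hasDerivAt_pi.1 (hasFDerivAt_snd.comp_hasDerivAt t h) k

theorem absolutelyContinuousOnInterval_fst_apply {s : ℝ → R.State} {a b : ℝ}
    (h : AbsolutelyContinuousOnInterval s a b) (i : {i : G.PrimalIdx // i ∉ R.redP}) :
    AbsolutelyContinuousOnInterval (fun t => (s t).1 i) a b :=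
  h.lipschitzWith_comp ((LipschitzWith.eval (α := fun _ => ℝ) i).comp LipschitzWith.prod_fst)

theorem absolutelyContinuousOnInterval_snd_apply {s : ℝ → R.State} {a b : ℝ}
    (h : AbsolutelyContinuousOnInterval s a b) (k : {k : G.DualIdx // k ∉ R.redD}) :
    AbsolutelyContinuousOnInterval (fun t => (s t).2 k) a b :=
  h.lipschitzWith_comp ((LipschitzWith.eval (α := fun _ => ℝ) k).comp LipschitzWith.prod_snd)

theorem hasDerivAt_energy {s : ℝ → R.State} {d : R.State} {t : ℝ} (h : HasDerivAt s d t) :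
    HasDerivAt (fun t => R.energy (s t)) (2 * R.wip d (s t)) t := by
  have h1 : HasDerivAt (fun t => ∑ i, R.τP i.1 * ((s t).1 i * (s t).1 i))
      (∑ i, R.τP i.1 * (d.1 i * (s t).1 i + (s t).1 i * d.1 i)) t :=
    HasDerivAt.fun_sum fun i _ =>
      ((hasDerivAt_fst_apply h i).mul (hasDerivAt_fst_apply h i)).const_mul _
  have h2 : HasDerivAt (fun t => ∑ k, R.τD k.1 * ((s t).2 k * (s t).2 k))
      (∑ k, R.τD k.1 * (d.2 k * (s t).2 k + (s t).2 k * d.2 k)) t :=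
    HasDerivAt.fun_sum fun k _ =>
      ((hasDerivAt_snd_apply h k).mul (hasDerivAt_snd_apply h k)).const_mul _
  refine (h1.add h2).congr_deriv ?_
  rw [wip, mul_add, Finset.mul_sum, Finset.mul_sum]
  congr 1
  · exact Finset.sum_congr rfl fun i _ => by ring
  · exact Finset.sum_congr rfl fun k _ => by ring

theorem absolutelyContinuousOnInterval_energy {s : ℝ → R.State} {a b : ℝ}
    (h : AbsolutelyContinuousOnInterval s a b) :
    AbsolutelyContinuousOnInterval (fun t => R.energy (s t)) a b := by
  refine AbsolutelyContinuousOnInterval.add ?_ ?_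
  · refine AbsolutelyContinuousOnInterval.finset_sum _ fun i _ => ?_
    have := absolutelyContinuousOnInterval_fst_apply h i
    exact (this.mul this).const_mul _
  · refine AbsolutelyContinuousOnInterval.finset_sum _ fun k _ => ?_
    have := absolutelyContinuousOnInterval_snd_apply h k
    exact (this.mul this).const_mul _

namespace IsTrajectory

theorem absolutelyContinuousOnInterval {s : ℝ → R.State} (hs : R.IsTrajectory s) {a b : ℝ}
    (ha : 0 ≤ a) (hab : a ≤ b) : AbsolutelyContinuousOnInterval s a b := by
  refine (hs.2.1 b (ha.trans hab)).mono ?_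
  rw [uIcc_of_le hab, uIcc_of_le (ha.trans hab)]
  exact Icc_subset_Icc_left ha

theorem ae_hasDerivAt {s : ℝ → R.State} (hs : R.IsTrajectory s) :
    ∀ᵐ t : ℝ, 0 ≤ t → HasDerivAt s (R.field (s t)) t :=
  (ae_restrict_iff' measurableSet_Ici).1 hs.2.2

/-- Where an `η`-entry is nonpositive, the projected velocity is nonnegative. -/
theorem mem_initialSet {s : ℝ → R.State} (hs : R.IsTrajectory s) {t : ℝ} (ht : 0 ≤ t) :
    s t ∈ R.initialSet := by
  intro k he
  refine (absolutelyContinuousOnInterval_snd_apply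
    (hs.absolutelyContinuousOnInterval le_rfl ht) k).nonneg_of_deriv_nonneg ht (hs.1 k he) ?_
  filter_upwards [hs.ae_hasDerivAt] with r hr hrI hneg
  rw [(hasDerivAt_snd_apply (hr hrI.1) k).deriv]
  simp only [field, if_pos he]
  refine mul_nonneg (inv_pos.2 (R.τD_pos k.1)).le ?_
  unfold proj
  split_ifs with hp
  · exact (hp.resolve_right (not_lt.2 hneg)).le
  · exact le_rfl

theorem shift {s : ℝ → R.State} (hs : R.IsTrajectory s) {c : ℝ} (hc : 0 ≤ c) :
    R.IsTrajectory fun t => s (c + t) := by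
  refine ⟨by simpa using hs.mem_initialSet hc, fun T hT => ?_, ?_⟩
  · have h := hs.absolutelyContinuousOnInterval hc (le_add_of_nonneg_right hT)
    rw [absolutelyContinuousOnInterval_iff] at h ⊢
    intro ε hε
    obtain ⟨δ, hδ, hall⟩ := h ε hε
    refine ⟨δ, hδ, fun E hE hlen => ?_⟩
    refine hall (E.1, fun n => (c + (E.2 n).1, c + (E.2 n).2)) ⟨fun n hn => ?_, ?_⟩ ?_
    · have := hE.1 n hn
      rw [uIcc_of_le hT] at this
      rw [uIcc_of_le (le_add_of_nonneg_right hT)]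
      exact ⟨⟨by linarith [this.1.1], by linarith [this.1.2]⟩,
        ⟨by linarith [this.2.1], by linarith [this.2.2]⟩⟩
    · intro m hm n hn hmn
      have := hE.2 hm hn hmn
      simp only [Function.onFun] at this ⊢
      rw [Set.disjoint_left] at this ⊢
      intro x hx hx'
      refine this (a := x - c) ?_ ?_
      · rw [mem_uIoc] at hx ⊢
        rcases hx with h | h
        · exact Or.inl ⟨by linarith [h.1], by linarith [h.2]⟩
        · exact Or.inr ⟨by linarith [h.1], by linarith [h.2]⟩
      · rw [mem_uIoc] at hx' ⊢
        rcases hx' with h | h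
        · exact Or.inl ⟨by linarith [h.1], by linarith [h.2]⟩
        · exact Or.inr ⟨by linarith [h.1], by linarith [h.2]⟩
    · simpa using hlen
  · rw [ae_restrict_iff' measurableSet_Ici]
    have h := (measurePreserving_add_left (volume : Measure ℝ) c).quasiMeasurePreserving.ae
      hs.ae_hasDerivAt
    filter_upwards [h] with t ht (ht0 : 0 ≤ t)
    exact (ht (add_nonneg hc ht0)).comp_const_add c t

/-- The weighted distance of two trajectories does not increase. -/
theorem energy_sub_le (hfin : R.Finiteness) (hdiff : R.LhatDifferentiable) {s r : ℝ → R.State}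
    (hs : R.IsTrajectory s) (hr : R.IsTrajectory r) {a b : ℝ} (ha : 0 ≤ a) (hab : a ≤ b) :
    R.energy (s b - r b) ≤ R.energy (s a - r a) := by
  refine (absolutelyContinuousOnInterval_energy
    ((hs.absolutelyContinuousOnInterval ha hab).sub
      (hr.absolutelyContinuousOnInterval ha hab))).le_of_deriv_nonpos hab ?_
  filter_upwards [hs.ae_hasDerivAt, hr.ae_hasDerivAt] with t h1 h2 htI
  have ht : 0 ≤ t := ha.trans htI.1
  rw [(hasDerivAt_energy ((h1 ht).sub (h2 ht))).deriv, Pi.sub_apply, wip_sub_left]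
  -- The variational inequality at each trajectory is tested against the other; in the sum all
  -- values of `L̂` cancel.
  have h3 := wip_field_le hfin hdiff (hs.mem_initialSet ht) (hr.mem_initialSet ht)
  have h4 := wip_field_le hfin hdiff (hr.mem_initialSet ht) (hs.mem_initialSet ht)
  rw [wip_sub_comm (R.field (r t)) (r t)] at h4
  linarith

end IsTrajectory

/-! ### Continuity, closedness and local bounds on the field -/

theorem continuous_Lhat (hdiff : R.LhatDifferentiable) :
    Continuous fun s : R.State => R.Lhat s.1 s.2 := hdiff.continuous

theorem continuous_gap (hdiff : R.LhatDifferentiable) (v : R.State) :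
    Continuous fun s : R.State => R.Lhat v.1 s.2 - R.Lhat s.1 v.2 :=
  ((differentiable_Lhat_right hdiff v.1).continuous.comp continuous_snd).sub
    ((differentiable_Lhat_left hdiff v.2).continuous.comp continuous_fst)

theorem isClosed_initialSet : IsClosed R.initialSet := by
  have : R.initialSet = ⋂ k, ⋂ _ : G.IsEta k.1, {s : R.State | 0 ≤ s.2 k} := by
    ext s
    simp [initialSet]
  rw [this]
  refine isClosed_iInter fun k => isClosed_iInter fun _ => isClosed_le continuous_const ?_
  exact (continuous_apply k).comp continuous_snd

theorem isTrajectory_const {e : R.State} (he : e ∈ R.equilibria) :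
    R.IsTrajectory fun _ => e := by
  refine ⟨he.1, fun T _ => ?_, Filter.Eventually.of_forall fun t => ?_⟩
  · exact (LipschitzWith.const e).lipschitzOnWith.absolutelyContinuousOnInterval
  · rw [he.2]
    exact hasDerivAt_const t e

/-- The field is bounded on bounded sets. -/
theorem exists_norm_field_le (hfin : R.Finiteness) (hdiff : R.LhatDifferentiable) (r : ℝ) :
    ∃ K : ℝ, 0 ≤ K ∧ ∀ s : R.State, ‖s‖ ≤ r →
      (∀ i, |(R.field s).1 i| ≤ K) ∧ ∀ k, |(R.field s).2 k| ≤ K := by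
  obtain ⟨M, hM⟩ := (isCompact_closedBall (0 : R.State) (r + 1)).exists_bound_of_continuousOn
    (continuous_Lhat hdiff).continuousOn
  have hM' : ∀ s : R.State, ‖s‖ ≤ r + 1 → |R.Lhat s.1 s.2| ≤ M := fun s hs =>
    hM s (mem_closedBall_zero_iff.2 hs)
  set B := ∑ i : {i : G.PrimalIdx // i ∉ R.redP}, (R.τP i.1)⁻¹ +
    ∑ k : {k : G.DualIdx // k ∉ R.redD}, (R.τD k.1)⁻¹ with hB
  have hBP : 0 ≤ ∑ i : {i : G.PrimalIdx // i ∉ R.redP}, (R.τP i.1)⁻¹ :=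
    Finset.sum_nonneg fun i _ => (inv_pos.2 (R.τP_pos i.1)).le
  have hBD : 0 ≤ ∑ k : {k : G.DualIdx // k ∉ R.redD}, (R.τD k.1)⁻¹ :=
    Finset.sum_nonneg fun k _ => (inv_pos.2 (R.τD_pos k.1)).le
  have hB0 : 0 ≤ B := add_nonneg hBP hBD
  refine ⟨B * (2 * |M|), by positivity, fun s hs => ?_⟩
  have hs1 := hM' s (by linarith)
  have hMabs := le_abs_self M
  have hgZ : ∀ i, |R.gradZ s i| ≤ 2 * |M| := by
    intro i
    -- Convexity bounds a partial derivative by the increment of `L̂` over a unit step, hence by its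
    -- bound on the ball of radius `r + 1`.
    have key : ∀ ε : ℝ, |ε| = 1 → R.gradZ s i * ε ≤ 2 * |M| := by
      intro ε hε
      have h1 := sum_gradZ_le hfin hdiff s (s.1 + Pi.single i ε)
      rw [Finset.sum_eq_single i (fun j _ hne => by simp [hne])
        (fun h => absurd (Finset.mem_univ _) h)] at h1
      simp only [Pi.add_apply, Pi.single_eq_same, add_sub_cancel_left] at h1
      have h2 := hM' (s + (Pi.single i ε, 0)) (by
        refine (norm_add_le _ _).trans (add_le_add hs ?_)
        simp [Prod.norm_def, Pi.norm_single, hε])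
      simp only [Prod.fst_add, Prod.snd_add, add_zero] at h2
      have := abs_le.1 h2
      have := abs_le.1 hs1
      linarith
    have h1 := key 1 (by simp)
    have h2 := key (-1) (by simp)
    exact abs_le.2 ⟨by linarith, by linarith⟩
  have hgσ : ∀ k, |R.gradσ s k| ≤ 2 * |M| := by
    intro k
    have key : ∀ ε : ℝ, |ε| = 1 → -(2 * |M|) ≤ R.gradσ s k * ε := by
      intro ε hε
      have h1 := le_sum_gradσ hfin hdiff s (s.2 + Pi.single k ε)
      rw [Finset.sum_eq_single k (fun j _ hne => by simp [hne])
        (fun h => absurd (Finset.mem_univ _) h)] at h1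
      simp only [Pi.add_apply, Pi.single_eq_same, add_sub_cancel_left] at h1
      have h2 := hM' (s + (0, Pi.single k ε)) (by
        refine (norm_add_le _ _).trans (add_le_add hs ?_)
        simp [Prod.norm_def, Pi.norm_single, hε])
      simp only [Prod.fst_add, Prod.snd_add, add_zero] at h2
      have := abs_le.1 h2
      have := abs_le.1 hs1
      linarith
    have h1 := key 1 (by simp)
    have h2 := key (-1) (by simp)
    exact abs_le.2 ⟨by linarith, by linarith⟩
  refine ⟨fun i => ?_, fun k => ?_⟩
  · have h1 := Finset.single_le_sum
      (f := fun i : {i : G.PrimalIdx // i ∉ R.redP} => (R.τP i.1)⁻¹)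
      (fun i _ => (inv_pos.2 (R.τP_pos i.1)).le) (Finset.mem_univ i)
    simp only [field]
    rw [abs_mul, abs_neg, abs_of_pos (inv_pos.2 (R.τP_pos i.1))]
    exact mul_le_mul (h1.trans (le_add_of_nonneg_right hBD)) (hgZ i) (abs_nonneg _) hB0
  · have h1 := Finset.single_le_sum
      (f := fun k : {k : G.DualIdx // k ∉ R.redD} => (R.τD k.1)⁻¹)
      (fun k _ => (inv_pos.2 (R.τD_pos k.1)).le) (Finset.mem_univ k)
    simp only [field]
    rw [abs_mul, abs_of_pos (inv_pos.2 (R.τD_pos k.1))]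
    refine mul_le_mul (h1.trans (le_add_of_nonneg_left hBP)) ?_ (abs_nonneg _) hB0
    unfold proj
    split_ifs
    · exact hgσ k
    · rw [abs_zero]
      positivity
    · exact hgσ k

theorem _root_.AbsolutelyContinuousOnInterval.abs_sub_le {f : ℝ → ℝ} {a b K : ℝ} (hab : a ≤ b)
    (hf : AbsolutelyContinuousOnInterval f a b)
    (h : ∀ᵐ t, t ∈ Icc a b → |deriv f t| ≤ K) : |f b - f a| ≤ K * (b - a) := by
  have h1 := hf.sub_le_integral (g := fun _ => K) hab (by simp) (by
    filter_upwards [h] with t ht htI using (abs_le.1 (ht htI)).2)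
  have h2 := hf.neg.sub_le_integral (g := fun _ => K) hab (by simp) (by
    filter_upwards [h] with t ht htI
    rw [deriv.neg]
    linarith [(abs_le.1 (ht htI)).1])
  simp only [intervalIntegral.integral_const, smul_eq_mul, Pi.neg_apply] at h1 h2
  exact abs_le.2 ⟨by linarith, by linarith⟩

/-! ### Integral form of the loop -/

/-- The integrated variational inequality along a trajectory. -/
theorem IsTrajectory.energy_sub_sub_le_integral (hfin : R.Finiteness)
    (hdiff : R.LhatDifferentiable) {s : ℝ → R.State} (hs : R.IsTrajectory s) {v : R.State}
    (hv : v ∈ R.initialSet) {a b : ℝ} (ha : 0 ≤ a) (hab : a ≤ b) :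
    R.energy (s b - v) - R.energy (s a - v) ≤
      ∫ t in a..b, 2 * (R.Lhat v.1 (s t).2 - R.Lhat (s t).1 v.2) := by
  have hac := hs.absolutelyContinuousOnInterval ha hab
  have hconst : AbsolutelyContinuousOnInterval (fun _ : ℝ => v) a b :=
    (LipschitzWith.const v).lipschitzOnWith.absolutelyContinuousOnInterval
  refine (absolutelyContinuousOnInterval_energy (hac.sub hconst)).sub_le_integral hab ?_ ?_
  · exact (((continuous_gap hdiff v).comp_continuousOn hac.continuousOn).const_mul
      2).intervalIntegrable
  · filter_upwards [hs.ae_hasDerivAt] with t h1 htI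
    have ht : 0 ≤ t := ha.trans htI.1
    rw [(hasDerivAt_energy ((h1 ht).sub (hasDerivAt_const t v))).deriv, sub_zero]
    have := wip_field_le hfin hdiff (hs.mem_initialSet ht) hv
    simp only [Pi.sub_apply]
    linarith

/-- The integrated variational inequality characterizes trajectories. -/
theorem isTrajectory_of_energy_sub_sub_le_integral (hdiff : R.LhatDifferentiable)
    {s : ℝ → R.State} {K : NNReal} (hK : LipschitzWith K s) (hs : ∀ t, s t ∈ R.initialSet)
    (h : ∀ v ∈ R.initialSet, ∀ a b : ℝ, 0 ≤ a → a ≤ b →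
      R.energy (s b - v) - R.energy (s a - v) ≤
        ∫ t in a..b, 2 * (R.Lhat v.1 (s t).2 - R.Lhat (s t).1 v.2)) :
    R.IsTrajectory s := by
  refine ⟨hs 0, fun T _ => hK.lipschitzOnWith.absolutelyContinuousOnInterval, ?_⟩
  rw [ae_restrict_iff' measurableSet_Ici]
  filter_upwards [hK.ae_differentiableAt_real] with t hdt (ht : 0 ≤ t)
  have hder : HasDerivAt s (deriv s t) t := hdt.hasDerivAt
  have : deriv s t = R.field (s t) := by
    refine eq_field_of_wip_le hdiff (hs t) (fun v hv => ?_) fun k he h0 => ?_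
    · have hg : Continuous fun x => 2 * (R.Lhat v.1 (s x).2 - R.Lhat (s x).1 v.2) :=
        ((continuous_gap hdiff v).comp hK.continuous).const_mul 2
      have h1 := hasDerivAt_energy (hder.sub (hasDerivAt_const t v))
      have h2 := (hg.integral_hasStrictDerivAt 0 t).hasDerivAt
      -- The energy minus the integral lies, just after `t`, at or below its value at `t`. Its
      -- derivative is therefore nonpositive, which is the pointwise inequality.
      have h3 := (h1.sub h2).nonpos_of_eventually_le (by
        filter_upwards [self_mem_nhdsWithin] with x (hx : t < x)
        have h4 := h v hv t x ht hx.le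
        have h5 := intervalIntegral.integral_add_adjacent_intervals
          (hg.intervalIntegrable (μ := volume) 0 t) (hg.intervalIntegrable t x)
        simp only [Pi.sub_apply]
        linarith)
      simp only [Pi.sub_apply, sub_zero] at h3
      linarith
    -- An `η`-entry that vanishes at `t` is minimal there, because it is nonnegative at all real
    -- times.
    · refine IsLocalMin.hasDerivAt_eq_zero (f := fun t => (s t).2 k) ?_
        (hasDerivAt_snd_apply hder k)
      refine Filter.Eventually.of_forall fun x => ?_
      simp only [h0]
      exact hs x k he
  exact this ▸ hder

/-! ### Asymptotic behaviour -/

namespace IsTrajectory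

theorem energy_sub_const_le (hfin : R.Finiteness) (hdiff : R.LhatDifferentiable)
    {s : ℝ → R.State} (hs : R.IsTrajectory s) {e : R.State} (he : e ∈ R.equilibria) {a b : ℝ}
    (ha : 0 ≤ a) (hab : a ≤ b) : R.energy (s b - e) ≤ R.energy (s a - e) :=
  hs.energy_sub_le hfin hdiff (isTrajectory_const he) ha hab

theorem exists_norm_le (hfin : R.Finiteness) (hdiff : R.LhatDifferentiable)
    {s : ℝ → R.State} (hs : R.IsTrajectory s) {e : R.State} (he : e ∈ R.equilibria) :
    ∃ r, ∀ t, 0 ≤ t → ‖s t‖ ≤ r := by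
  obtain ⟨K, hK0, hK⟩ := exists_energy_bounds R
  refine ⟨Real.sqrt (K * R.energy (s 0 - e)) + ‖e‖, fun t ht => ?_⟩
  have h1 := (hK (s t - e)).2
  have h2 := mul_le_mul_of_nonneg_left (hs.energy_sub_const_le hfin hdiff he le_rfl ht) hK0.le
  have h3 : ‖s t - e‖ ≤ Real.sqrt (K * R.energy (s 0 - e)) := Real.le_sqrt_of_sq_le (h1.trans h2)
  have h4 : ‖s t‖ ≤ ‖s t - e‖ + ‖e‖ := by simpa using norm_add_le (s t - e) e
  linarith

theorem exists_dist_le (hfin : R.Finiteness) (hdiff : R.LhatDifferentiable)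
    {s : ℝ → R.State} (hs : R.IsTrajectory s) {e : R.State} (he : e ∈ R.equilibria) :
    ∃ K : NNReal, ∀ a b : ℝ, 0 ≤ a → 0 ≤ b → dist (s a) (s b) ≤ K * dist a b := by
  obtain ⟨r, hr⟩ := hs.exists_norm_le hfin hdiff he
  obtain ⟨K, hK0, hK⟩ := exists_norm_field_le hfin hdiff r
  have key : ∀ a b : ℝ, 0 ≤ a → a ≤ b → dist (s b) (s a) ≤ K * (b - a) := by
    intro a b ha hab
    have hac := hs.absolutelyContinuousOnInterval ha hab
    have hnn : 0 ≤ K * (b - a) := mul_nonneg hK0 (by linarith)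
    rw [dist_eq_norm]
    refine max_le ((pi_norm_le_iff_of_nonneg hnn).2 fun i => ?_)
      ((pi_norm_le_iff_of_nonneg hnn).2 fun k => ?_)
    · refine (absolutelyContinuousOnInterval_fst_apply hac i).abs_sub_le hab ?_
      filter_upwards [hs.ae_hasDerivAt] with t ht htI
      have ht0 : 0 ≤ t := ha.trans htI.1
      rw [(hasDerivAt_fst_apply (ht ht0) i).deriv]
      exact (hK _ (hr t ht0)).1 i
    · refine (absolutelyContinuousOnInterval_snd_apply hac k).abs_sub_le hab ?_
      filter_upwards [hs.ae_hasDerivAt] with t ht htI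
      have ht0 : 0 ≤ t := ha.trans htI.1
      rw [(hasDerivAt_snd_apply (ht ht0) k).deriv]
      exact (hK _ (hr t ht0)).2 k
  refine ⟨⟨K, hK0⟩, fun a b ha hb => ?_⟩
  rcases le_total a b with hab | hab
  · rw [dist_comm, dist_comm a b, Real.dist_eq, abs_of_nonneg (by linarith)]
    exact key a b ha hab
  · rw [Real.dist_eq, abs_of_nonneg (by linarith)]
    exact key b a hb hab

/-- If a trajectory converges along a sequence of times, then its shifts along this sequence
converge pointwise to a trajectory. -/
theorem exists_limit_trajectory (hfin : R.Finiteness) (hdiff : R.LhatDifferentiable)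
    {s : ℝ → R.State} (hs : R.IsTrajectory s) {e : R.State} (he : e ∈ R.equilibria)
    {τ : ℕ → ℝ} (hτ : ∀ n, 0 ≤ τ n) {a : R.State}
    (ha : Filter.Tendsto (fun n => s (τ n)) Filter.atTop (𝓝 a)) :
    ∃ l : ℝ → R.State, Continuous l ∧ R.IsTrajectory l ∧
      ∀ t, 0 ≤ t → Filter.Tendsto (fun n => s (τ n + t)) Filter.atTop (𝓝 (l t)) := by
  obtain ⟨C, hC0, hC⟩ := exists_energy_bounds R
  obtain ⟨K, hK⟩ := hs.exists_dist_le hfin hdiff he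
  obtain ⟨r, hr⟩ := hs.exists_norm_le hfin hdiff he
  have hcontract : ∀ m n t, 0 ≤ t →
      dist (s (τ m + t)) (s (τ n + t)) ≤ C * dist (s (τ m)) (s (τ n)) := by
    intro m n t ht
    -- Contraction between two shifts carries the Cauchy property from time `0` to every later time,
    -- so no further subsequence is needed.
    have h1 := (hs.shift (hτ m)).energy_sub_le hfin hdiff (hs.shift (hτ n)) le_rfl ht
    simp only [add_zero] at h1
    rw [dist_eq_norm, dist_eq_norm]
    refine le_of_sq_le_sq ?_ (mul_nonneg hC0.le (norm_nonneg _))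
    calc ‖s (τ m + t) - s (τ n + t)‖ ^ 2 ≤ C * R.energy (s (τ m + t) - s (τ n + t)) := (hC _).2
      _ ≤ C * R.energy (s (τ m) - s (τ n)) := mul_le_mul_of_nonneg_left h1 hC0.le
      _ ≤ C * (C * ‖s (τ m) - s (τ n)‖ ^ 2) := mul_le_mul_of_nonneg_left (hC _).1 hC0.le
      _ = _ := by ring
  -- Freezing negative times at `0` makes the limit Lipschitz and `𝕀`-valued on the whole line.
  have hlim : ∀ t : ℝ, ∃ y, Filter.Tendsto (fun n => s (τ n + max t 0)) Filter.atTop (𝓝 y) := by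
    intro t
    refine cauchySeq_tendsto_of_complete (Metric.cauchySeq_iff.2 fun ε hε => ?_)
    obtain ⟨n₀, hn₀⟩ := Metric.cauchySeq_iff.1 ha.cauchySeq (ε / C) (div_pos hε hC0)
    refine ⟨n₀, fun m hm n hn => (hcontract m n _ (le_max_right t 0)).trans_lt ?_⟩
    have := mul_lt_mul_of_pos_left (hn₀ m hm n hn) hC0
    rwa [mul_div_cancel₀ _ hC0.ne'] at this
  choose l hl using hlim
  have hnn : ∀ n (t : ℝ), 0 ≤ τ n + max t 0 := fun n t => add_nonneg (hτ n) (le_max_right t 0)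
  have hLip : LipschitzWith K l := LipschitzWith.of_dist_le_mul fun x y => by
    refine le_of_tendsto' ((hl x).dist (hl y)) fun n => (hK _ _ (hnn n x) (hnn n y)).trans ?_
    refine mul_le_mul_of_nonneg_left ?_ K.2
    rw [dist_add_left, Real.dist_eq, Real.dist_eq]
    exact abs_max_sub_max_le_abs x y 0
  refine ⟨l, hLip.continuous, isTrajectory_of_energy_sub_sub_le_integral hdiff hLip
    (fun t => isClosed_initialSet.mem_of_tendsto (hl t)
      (Filter.Eventually.of_forall fun n => hs.mem_initialSet (hnn n t)))
    (fun v hv x y hx hxy => ?_), fun t ht => by simpa [max_eq_left ht] using hl t⟩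
  have henergy : ∀ t, Filter.Tendsto (fun n => R.energy (s (τ n + max t 0) - v)) Filter.atTop
      (𝓝 (R.energy (l t - v))) := fun t =>
    (continuous_energy.tendsto _).comp ((hl t).sub_const v)
  have hgap := continuous_gap hdiff v
  obtain ⟨M, hM⟩ := (isCompact_closedBall (0 : R.State) r).exists_bound_of_continuousOn
    (hgap.const_mul 2 |>.continuousOn)
  have hcont : ∀ n, ContinuousOn (fun t => s (τ n + max t 0)) univ := by
    intro n
    have : LipschitzWith K fun t => s (τ n + max t 0) := LipschitzWith.of_dist_le_mul fun x y => by
      refine (hK _ _ (hnn n x) (hnn n y)).trans (mul_le_mul_of_nonneg_left ?_ K.2)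
      rw [dist_add_left, Real.dist_eq, Real.dist_eq]
      exact abs_max_sub_max_le_abs x y 0
    exact this.continuous.continuousOn
  have hint : Filter.Tendsto (fun n => ∫ t in x..y, 2 * (R.Lhat v.1 (s (τ n + max t 0)).2 -
      R.Lhat (s (τ n + max t 0)).1 v.2)) Filter.atTop
      (𝓝 (∫ t in x..y, 2 * (R.Lhat v.1 (l t).2 - R.Lhat (l t).1 v.2))) := by
    refine intervalIntegral.tendsto_integral_filter_of_dominated_convergence (fun _ => M)
      (Filter.Eventually.of_forall fun n => ?_) (Filter.Eventually.of_forall fun n => ?_)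
      (by simp) (Filter.Eventually.of_forall fun t _ => ?_)
    · exact ((hgap.const_mul 2).comp
        (continuousOn_univ.1 (hcont n))).aestronglyMeasurable
    · exact Filter.Eventually.of_forall fun t _ =>
        hM _ (mem_closedBall_zero_iff.2 (hr _ (hnn n t)))
    · exact ((hgap.const_mul 2).tendsto (l t)).comp (hl t)
  refine le_of_tendsto_of_tendsto' ((henergy y).sub (henergy x)) hint fun n => ?_
  have h1 := (hs.shift (hτ n)).energy_sub_sub_le_integral hfin hdiff hv hx hxy
  have h2 : ∫ t in x..y, 2 * (R.Lhat v.1 (s (τ n + t)).2 - R.Lhat (s (τ n + t)).1 v.2) =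
      ∫ t in x..y, 2 * (R.Lhat v.1 (s (τ n + max t 0)).2 - R.Lhat (s (τ n + max t 0)).1 v.2) := by
    refine intervalIntegral.integral_congr fun t ht => ?_
    rw [uIcc_of_le hxy] at ht
    have : max t 0 = t := max_eq_left (hx.trans ht.1)
    simp only [this]
  rw [h2] at h1
  rwa [max_eq_left hx, max_eq_left (hx.trans hxy)]

/-- A limit trajectory consists of equilibria at almost every time. -/
theorem exists_mem_equilibria_of_limit (hfin : R.Finiteness) (hdiff : R.LhatDifferentiable)
    (hobs : R.Observability) {l : ℝ → R.State} (hlc : Continuous l) (hl : R.IsTrajectory l)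
    {e : R.State} (he : e ∈ R.equilibria) {c : ℝ}
    (hconst : ∀ t, 0 ≤ t → R.energy (l t - e) = c) :
    ∃ t, 0 ≤ t ∧ l t ∈ R.equilibria := by
  have hsad := ((mem_equilibria_iff_isSaddle hfin hdiff e).1 he).2
  have hup : ∀ t, 0 ≤ t → R.Lhat e.1 (l t).2 ≤ R.Lhat e.1 e.2 := fun t ht =>
    hsad (e.1, (l t).2) (hl.mem_initialSet ht)
  have hlow : ∀ t : ℝ, R.Lhat e.1 e.2 ≤ R.Lhat (l t).1 e.2 := fun t =>
    hsad ((l t).1, e.2) he.1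
  have hg : Continuous fun t => R.Lhat (l t).1 e.2 - R.Lhat e.1 (l t).2 := by
    refine ((continuous_gap hdiff e).comp hlc).neg.congr fun t => ?_
    simp only [Pi.neg_apply, Function.comp_apply, neg_sub]
  -- The saddle gap is continuous and nonnegative. Were it positive somewhere, the integrated
  -- inequality would force the energy to decrease.
  have hzero : ∀ t, 0 ≤ t → R.Lhat (l t).1 e.2 - R.Lhat e.1 (l t).2 = 0 := by
    intro t ht
    by_contra hne
    have hpos : 0 < R.Lhat (l t).1 e.2 - R.Lhat e.1 (l t).2 :=
      lt_of_le_of_ne (by linarith [hup t ht, hlow t]) (Ne.symm hne)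
    have h1 := intervalIntegral.integral_pos (lt_add_one t) hg.continuousOn
      (fun x hx => by linarith [hup x (ht.trans hx.1.le), hlow x])
      ⟨t, ⟨le_rfl, (lt_add_one t).le⟩, hpos⟩
    have h2 := hl.energy_sub_sub_le_integral hfin hdiff he.1 ht (lt_add_one t).le
    rw [hconst t ht, hconst (t + 1) (by linarith), sub_self] at h2
    have h3 : ∫ x in t..(t + 1), 2 * (R.Lhat e.1 (l x).2 - R.Lhat (l x).1 e.2) =
        -2 * ∫ x in t..(t + 1), (R.Lhat (l x).1 e.2 - R.Lhat e.1 (l x).2) := by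
      rw [← intervalIntegral.integral_const_mul]
      exact intervalIntegral.integral_congr fun x _ => by ring
    rw [h3] at h2
    linarith
  have hstat := hobs e he l hl
    (fun t ht => by linarith [hup t ht, hlow t, hzero t ht])
    (fun t ht => by linarith [hup t ht, hlow t, hzero t ht])
  -- Stationarity holds at every `t ≥ 0`, the differential equation only almost everywhere. At one
  -- common time the field vanishes.
  have hae : ∀ᵐ t ∂(volume.restrict (Ici (0 : ℝ))), 0 ≤ t ∧ HasDerivAt l (R.field (l t)) t :=
    (ae_restrict_mem measurableSet_Ici).and hl.2.2
  have hne : (ae (volume.restrict (Ici (0 : ℝ)))).NeBot := by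
    rw [ae_neBot, Ne, Measure.restrict_eq_zero, Real.volume_Ici]
    exact ENNReal.top_ne_zero
  obtain ⟨t, ht, hder⟩ := hae.exists
  refine ⟨t, ht, hl.mem_initialSet ht, ?_⟩
  exact (uniqueDiffOn_Ici 0 t ht).eq_deriv _ hder.hasDerivWithinAt (hstat t ht)

/-- Each trajectory converges to an equilibrium. -/
theorem exists_tendsto (hfin : R.Finiteness) (hdiff : R.LhatDifferentiable)
    (hobs : R.Observability) {s : ℝ → R.State} (hs : R.IsTrajectory s) {e : R.State}
    (he : e ∈ R.equilibria) :
    ∃ e' ∈ R.equilibria, Filter.Tendsto s Filter.atTop (𝓝 e') := by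
  obtain ⟨r, hr⟩ := hs.exists_norm_le hfin hdiff he
  obtain ⟨a, -, φ, hφ, hlim⟩ := tendsto_subseq_of_bounded (x := fun n : ℕ => s n)
    (Metric.isBounded_closedBall (x := (0 : R.State)) (r := r))
    fun n => mem_closedBall_zero_iff.2 (hr n n.cast_nonneg)
  obtain ⟨l, hlc, hl, hlt⟩ := hs.exists_limit_trajectory hfin hdiff he
    (τ := fun n => ((φ n : ℕ) : ℝ)) (fun n => Nat.cast_nonneg _) hlim
  have hanti : ∀ e ∈ R.equilibria, Antitone fun t : ℝ => R.energy (s (max t 0) - e) :=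
    fun e he x y hxy => hs.energy_sub_const_le hfin hdiff he (le_max_right x 0)
      (max_le_max_right 0 hxy)
  have hconv : ∀ e ∈ R.equilibria, Filter.Tendsto (fun t : ℝ => R.energy (s (max t 0) - e))
      Filter.atTop (𝓝 (⨅ t : ℝ, R.energy (s (max t 0) - e))) := fun e he =>
    tendsto_atTop_ciInf (hanti e he) ⟨0, by rintro _ ⟨t, rfl⟩; exact energy_nonneg _⟩
  have htime : ∀ t : ℝ, Filter.Tendsto (fun n => ((φ n : ℕ) : ℝ) + t) Filter.atTop Filter.atTop :=
    fun t => Filter.tendsto_atTop_add_const_right _ t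
      (tendsto_natCast_atTop_atTop.comp hφ.tendsto_atTop)
  -- The energy along `s` is monotone, so every point of the limit trajectory has the same limiting
  -- energy relative to `e`.
  have hval : ∀ e ∈ R.equilibria, ∀ t, 0 ≤ t →
      R.energy (l t - e) = ⨅ t : ℝ, R.energy (s (max t 0) - e) := by
    intro e he t ht
    have h1 : Filter.Tendsto (fun n => R.energy (s (φ n + t) - e)) Filter.atTop
        (𝓝 (R.energy (l t - e))) :=
      (continuous_energy.tendsto _).comp ((hlt t ht).sub_const e)
    refine tendsto_nhds_unique h1 (((hconv e he).comp (htime t)).congr fun n => ?_)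
    have : 0 ≤ (φ n : ℝ) + t := by positivity
    simp only [Function.comp_apply, max_eq_left this]
  obtain ⟨t, ht, he'⟩ := exists_mem_equilibria_of_limit hfin hdiff hobs hlc hl he (hval e he)
  refine ⟨l t, he', ?_⟩
  obtain ⟨C, hC0, hC⟩ := exists_energy_bounds R
  -- Taking the equilibrium `l t` itself as reference point, the limiting energy is `energy 0 = 0`.
  have h0 := hconv (l t) he'
  rw [← hval (l t) he' t ht, sub_self, energy_zero] at h0
  rw [tendsto_iff_norm_sub_tendsto_zero]
  have h1 : Filter.Tendsto (fun x => Real.sqrt (C * R.energy (s (max x 0) - l t)))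
      Filter.atTop (𝓝 0) := by
    simpa using (h0.const_mul C).sqrt
  refine squeeze_zero' (Filter.Eventually.of_forall fun x => norm_nonneg _) ?_ h1
  filter_upwards [Filter.eventually_ge_atTop 0] with x hx
  rw [max_eq_left hx]
  exact Real.le_sqrt_of_sq_le (hC _).2

end IsTrajectory

/-! ### Existence and Lyapunov stability of equilibria -/

theorem equilibria_nonempty (hfeas : ∃ p q ω θ, G.IsFeasible p q ω θ) (hfin : R.Finiteness)
    (hdiff : R.LhatDifferentiable) : R.equilibria.Nonempty := by
  obtain ⟨e, he⟩ := exists_isSaddle (R := R) hfeas hfin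
  exact ⟨e, (mem_equilibria_iff_isSaddle hfin hdiff e).2 he⟩

/-- The set of equilibria is stable in the sense of Lyapunov. -/
theorem lyapunov_stable_equilibria (hfin : R.Finiteness) (hdiff : R.LhatDifferentiable)
    (hne : R.equilibria.Nonempty) {ε : ℝ} (hε : 0 < ε) :
    ∃ δ > 0, ∀ s : ℝ → R.State, R.IsTrajectory s → Metric.infDist (s 0) R.equilibria < δ →
      ∀ t, 0 ≤ t → Metric.infDist (s t) R.equilibria < ε := by
  obtain ⟨C, hC0, hC⟩ := exists_energy_bounds R
  -- Passing from the norm to the energy and back costs a factor `C` each way on squares, hence `C`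
  -- on distances.
  refine ⟨ε / C, div_pos hε hC0, fun s hs hlt t ht => ?_⟩
  obtain ⟨e, he, hdist⟩ := (Metric.infDist_lt_iff hne).1 hlt
  refine (Metric.infDist_le_dist_of_mem he).trans_lt ?_
  rw [dist_eq_norm, lt_div_iff₀ hC0] at hdist
  refine lt_of_le_of_lt ?_ hdist
  rw [dist_eq_norm]
  refine le_of_sq_le_sq ?_ (mul_nonneg (norm_nonneg _) hC0.le)
  calc ‖s t - e‖ ^ 2 ≤ C * R.energy (s t - e) := (hC _).2
    _ ≤ C * R.energy (s 0 - e) :=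
      mul_le_mul_of_nonneg_left (hs.energy_sub_const_le hfin hdiff he le_rfl ht) hC0.le
    _ ≤ C * (C * ‖s 0 - e‖ ^ 2) := mul_le_mul_of_nonneg_left (hC _).1 hC0.le
    _ = _ := by ring

end Design
end GridMarket
end

theorem theorem3 {N : Type*} [Fintype N] [DecidableEq N]
    (G : GridMarket.Network N)
    (hfeas : ∃ p q ω θ, G.IsFeasible p q ω θ)
    (R : GridMarket.Design G)
    (hfin : R.Finiteness)
    (hdiff : R.LhatDifferentiable)
    (hobs : R.Observability) :
    R.GloballyAsymptoticallyStable R.equilibria ∧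
    ∀ s : ℝ → R.State, R.IsTrajectory s →
      Bornology.IsBounded (s '' Set.Ici 0) ∧
      ∃ sEq ∈ R.equilibria, R.CorrespondsToOptimum sEq ∧
        Filter.Tendsto s Filter.atTop (𝓝 sEq) := by
  have hne := GridMarket.Design.equilibria_nonempty (R := R) hfeas hfin hdiff
  have ⟨e, he⟩ := hne
  refine ⟨⟨hne, fun ε hε => GridMarket.Design.lyapunov_stable_equilibria hfin hdiff hne hε,
    fun s hs => ?_⟩, fun s hs => ⟨?_, ?_⟩⟩
  · obtain ⟨e', he', hlim⟩ := hs.exists_tendsto hfin hdiff hobs he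
    have h := ((Metric.continuous_infDist_pt R.equilibria).tendsto e').comp hlim
    rwa [Metric.infDist_zero_of_mem he'] at h
  · obtain ⟨r, hr⟩ := hs.exists_norm_le hfin hdiff he
    refine isBounded_iff_forall_norm_le.2 ⟨r, ?_⟩
    rintro _ ⟨t, ht, rfl⟩
    exact hr t ht
  · obtain ⟨e', he', hlim⟩ := hs.exists_tendsto hfin hdiff hobs he
    exact ⟨e', he', ((GridMarket.Design.mem_equilibria_iff_isSaddle hfin hdiff e').1
      he').correspondsToOptimum hfeas hfin, hlim⟩
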